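/- Let $\mathbb K=\mathbb R$ or $\mathbb C$, let $n\ge 0$, and regard $\mathbb P^n=\mathbb P^n(\mathbb K)$ as a real algebraic manifold. Semialgebraic sets, differentials and dimensions are meant in the real sense, smooth means $C^1$, and $\dim\emptyset=-\infty$. Let $\mathcal S$ be an algebraic stratification of $\mathbb P^n$: a finite partition of $\mathbb P^n$ into smooth semialgebraic submanifolds (strata) that are the connected components of the sets $X_j\setminus X_{j-1}$, $0\le j\le n$, for a filtration $\mathbb P^n=X_n\supset X_{n-1}\supset\dots\supset X_0\supset X_{-1}=\emptyset$ by algebraic subsets over $\mathbb K$ such that, for each $j$, either $\dim_{\mathbb K}X_j=j$ or $X_j=X_{j-1}$, and $\operatorname{Sing}(X_j)\subset X_{j-1}$. Let $U$ be an open semialgebraic neighborhood of $0$ in $\mathbb K^{n+1}$ and let $\Psi:U\times\mathbb P^n\to\mathbb P^n$, $\Psi_t(x)=\Psi(t,x)$, be a semialgebraic map with $\Psi(0,x)=x$ for all $x$ that is a stratified submersive family of diffeomorphisms with respect to $\mathcal S$; that is, for every stratum $S\in\mathcal S$ we have $\Psi(U\times S)\subset S$, the map $\Psi:U\times S\to S$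 is $C^1$, $\Psi_t:S\to S$ is a $C^1$ diffeomorphism for every $t\in U$, and for all $(t,x)\in U\times S$ the differential at $t$ of the map $U\to S$, $\tau\mapsto\Psi(\tau,x)$, is onto the tangent space of $S$ at $\Psi(t,x)$. Let $Z$ and $W$ be semialgebraic subsets of $\mathbb P^n$. Then there is an open dense semialgebraic subset $U'$ of $U$ such that, for all $t\in U'$ and all strata $S\in\mathcal S$, $$\dim\bigl(Z\cap\Psi_t^{-1}(W)\cap S\bigr)\le\dim(Z\cap S)+\dim(W\cap S)-\dim S .$$ -/

import Mathlib

open Set Module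
open scoped Topology

noncomputable section

/-! ### Semialgebraic sets and their dimension in a real vector space -/

/-- The ring of polynomial functions on a subset `A` of a real vector space `E`: the algebra of
functions on `A` generated by the constants and the restrictions of the linear forms on `E`.
When `E = ℝ ^ N` this is `ℝ[x₁, …, x_N] / I(A)`. -/
def polyFunctionsOn {E : Type*} [AddCommGroup E] [Module ℝ E] (A : Set E) :
    Subalgebra ℝ (A → ℝ) :=
  Algebra.adjoin ℝ (range fun (l : E →ₗ[ℝ] ℝ) (a : A) => l a)

/-- Semialgebraic subsets of a real vector space: the Boolean algebra of sets generated by the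
sets `{f > 0}` with `f` a polynomial function. -/
inductive IsSemialgebraic {E : Type*} [AddCommGroup E] [Module ℝ E] : Set E → Prop
  | pos (f : E → ℝ) (hf : f ∈ Algebra.adjoin ℝ (range fun (l : E →ₗ[ℝ] ℝ) (x : E) => l x)) :
      IsSemialgebraic {x | 0 < f x}
  | compl (A : Set E) : IsSemialgebraic A → IsSemialgebraic Aᶜ
  | union (A B : Set E) : IsSemialgebraic A → IsSemialgebraic B → IsSemialgebraic (A ∪ B)

/-- The dimension of a (semialgebraic) set: the Krull dimension of its ring of polynomial
functions. It is `⊥` (that is, `-∞`) for the empty set. -/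
def semialgDim {E : Type*} [AddCommGroup E] [Module ℝ E] (A : Set E) : WithBot ℕ∞ :=
  ringKrullDim (polyFunctionsOn A)

/-! ### `C¹` submanifolds of a real normed space -/

/-- `A` is an embedded `C¹` submanifold of `E`, of pure dimension `d`: near each of its points it
is the zero set of a `C¹` submersion onto `ℝ ^ m`, where `m + d = dim E`. -/
def IsC1Submanifold {E : Type*} [NormedAddCommGroup E] [NormedSpace ℝ E] (d : ℕ) (A : Set E) :
    Prop :=
  ∀ x ∈ A, ∃ (m : ℕ) (O : Set E) (g : E → Fin m → ℝ), m + d = finrank ℝ E ∧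
    IsOpen O ∧ x ∈ O ∧ ContDiffOn ℝ 1 g O ∧ Function.Surjective (fderiv ℝ g x) ∧
    A ∩ O = {y ∈ O | g y = 0}

/-- The tangent space at `x` of a submanifold `A` of `E`, as a subspace of `E`. -/
def tangentSpaceOf {E : Type*} [NormedAddCommGroup E] [NormedSpace ℝ E] (A : Set E) (x : E) :
    Submodule ℝ E :=
  Submodule.span ℝ (tangentConeAt ℝ A x)

/-! ### Projective space as a real algebraic manifold -/

/-- The projective space `ℙⁿ` over `𝕜`. -/
abbrev ProjSpace (𝕜 : Type*) [RCLike 𝕜] (n : ℕ) : Type _ :=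
  Projectivization 𝕜 (Fin (n + 1) → 𝕜)

/-- The real vector space of square matrices of size `n + 1` over `𝕜`. -/
abbrev MatSpace (𝕜 : Type*) (n : ℕ) : Type _ :=
  Fin (n + 1) → Fin (n + 1) → 𝕜

/-- The standard closed embedding of `ℙⁿ` as a real algebraic submanifold of the space of
matrices: the line spanned by `v` goes to the matrix `v v* / |v|²` of the orthogonal projection
onto it (any nonzero `v` on the line gives the same matrix, see `projEmb_mk`). The topology, the
real manifold structure and the semialgebraic structure of `ℙⁿ` are those induced by this
embedding; they agree with the ones given by the affine charts. -/
def projEmb {𝕜 : Type*} [RCLike 𝕜] {n : ℕ} (x : ProjSpace 𝕜 n) : MatSpace 𝕜 n :=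
  fun i j => x.rep i * star (x.rep j) / ∑ k, x.rep k * star (x.rep k)

theorem projEmb_mk {𝕜 : Type*} [RCLike 𝕜] {n : ℕ} (v : Fin (n + 1) → 𝕜) (hv : v ≠ 0) :
    projEmb (Projectivization.mk 𝕜 v hv) =
      fun i j => v i * star (v j) / ∑ k, v k * star (v k) := by
  obtain ⟨a, ha⟩ := Projectivization.exists_smul_eq_mk_rep 𝕜 v hv
  have ha' : (a : 𝕜) * star (a : 𝕜) ≠ 0 := mul_ne_zero a.ne_zero (star_ne_zero.2 a.ne_zero)
  have hr : ∀ i, (Projectivization.mk 𝕜 v hv).rep i = a * v i := fun i => by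
    rw [← ha]; rfl
  have hm : ∀ i j, (a : 𝕜) * v i * star ((a : 𝕜) * v j) =
      (a * star (a : 𝕜)) * (v i * star (v j)) := fun i j => by
    rw [star_mul']; ring
  funext i j
  simp only [projEmb, hr, hm, ← Finset.mul_sum]
  exact mul_div_mul_left _ _ ha'

theorem projEmb_injective {𝕜 : Type*} [RCLike 𝕜] {n : ℕ} :
    Function.Injective (projEmb : ProjSpace 𝕜 n → MatSpace 𝕜 n) := by
  intro x y h
  have hs : ∀ z : ProjSpace 𝕜 n, ∑ k, z.rep k * star (z.rep k) ≠ 0 := fun z h0 => by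
    apply z.rep_nonzero
    have h1 : ∑ k, ‖z.rep k‖ ^ 2 = 0 := by
      have : ((∑ k, ‖z.rep k‖ ^ 2 : ℝ) : 𝕜) = 0 := by
        rw [← h0]; push_cast
        exact Finset.sum_congr rfl fun k _ => (RCLike.mul_conj _).symm
      exact_mod_cast this
    funext k
    have := (Finset.sum_eq_zero_iff_of_nonneg (fun k _ => by positivity)).1 h1 k (Finset.mem_univ k)
    simpa using this
  obtain ⟨j, hj⟩ := Function.ne_iff.1 x.rep_nonzero
  have key : ∀ i, x.rep i * star (x.rep j) / ∑ k, x.rep k * star (x.rep k) =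
      y.rep i * star (y.rep j) / ∑ k, y.rep k * star (y.rep k) := fun i => congrFun (congrFun h i) j
  rw [← x.mk_rep, ← y.mk_rep, Projectivization.mk_eq_mk_iff']
  have hj' : star (x.rep j) ≠ 0 := star_ne_zero.2 hj
  refine ⟨(∑ k, x.rep k * star (x.rep k)) / star (x.rep j) *
    (star (y.rep j) / ∑ k, y.rep k * star (y.rep k)), ?_⟩
  funext i
  have hi := key i
  have h1 := hs x
  have h2 := hs y
  simp only [Pi.smul_apply, smul_eq_mul]
  calc _ = (∑ k, x.rep k * star (x.rep k)) / star (x.rep j) *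
        (y.rep i * star (y.rep j) / ∑ k, y.rep k * star (y.rep k)) := by ring
    _ = x.rep i := by rw [← hi]; field_simp

/-- Semialgebraic subsets of `ℙⁿ`. -/
def IsProjSemialgebraic {𝕜 : Type*} [RCLike 𝕜] {n : ℕ} (A : Set (ProjSpace 𝕜 n)) : Prop :=
  IsSemialgebraic (projEmb '' A)

/-- The (real) dimension of a semialgebraic subset of `ℙⁿ`. -/
def projDim {𝕜 : Type*} [RCLike 𝕜] {n : ℕ} (A : Set (ProjSpace 𝕜 n)) : WithBot ℕ∞ :=
  semialgDim (projEmb '' A)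

/-! ### Algebraic subsets of projective space and their nonsingular points -/

/-- `V` is the common zero set in `ℙⁿ` of a set of homogeneous polynomials over `𝕜`. -/
def IsProjAlgebraic {𝕜 : Type*} [RCLike 𝕜] {n : ℕ} (V : Set (ProjSpace 𝕜 n)) : Prop :=
  ∃ P : Set (MvPolynomial (Fin (n + 1)) 𝕜), (∀ p ∈ P, ∃ e, p.IsHomogeneous e) ∧
    V = {x | ∀ p ∈ P, MvPolynomial.eval x.rep p = 0}

/-- The point `x` of the algebraic set `V` is nonsingular (the local ring of `V` at `x` is regular):
there are homogeneous polynomials over `𝕜` that vanish on `V`, have linearly independent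
differentials at `x`, and define `V` in a neighborhood of `x`. -/
def IsNonsingularAt {𝕜 : Type*} [RCLike 𝕜] {n : ℕ} (V : Set (ProjSpace 𝕜 n))
    (x : ProjSpace 𝕜 n) : Prop :=
  ∃ (m : ℕ) (f : Fin m → MvPolynomial (Fin (n + 1)) 𝕜),
    (∀ i, ∃ e, (f i).IsHomogeneous e) ∧
    (∀ i, ∀ y ∈ V, MvPolynomial.eval y.rep (f i) = 0) ∧
    LinearIndependent 𝕜 (fun i k => MvPolynomial.eval x.rep (MvPolynomial.pderiv k (f i))) ∧
    ∃ O : Set (MatSpace 𝕜 n), IsOpen O ∧ projEmb x ∈ O ∧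
      ∀ y, projEmb y ∈ O → (∀ i, MvPolynomial.eval y.rep (f i) = 0) → y ∈ V

/-! ### Stratifications -/

/-- A stratification of `ℙⁿ`: a partition into smooth semialgebraic manifolds. As `ℙⁿ` is compact,
a locally finite partition is finite. -/
structure IsStratification {𝕜 : Type*} [RCLike 𝕜] {n : ℕ} (𝒮 : Set (Set (ProjSpace 𝕜 n))) :
    Prop where
  isPartition : Setoid.IsPartition 𝒮
  finite : 𝒮.Finite
  semialgebraic : ∀ S ∈ 𝒮, IsProjSemialgebraic S
  smooth : ∀ S ∈ 𝒮, ∃ d, IsC1Submanifold d (projEmb '' S)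

/-- An algebraic stratification of `ℙⁿ`: a stratification that comes from a filtration
`ℙⁿ = X n ⊇ X (n - 1) ⊇ … ⊇ X 0 ⊇ X (-1) = ∅` by algebraic subsets such that, for each `j`,
either `X j` has dimension `j` over `𝕜` (real dimension `j` or `2 j`) or `X j = X (j - 1)`, and
the singular points of `X j` lie in `X (j - 1)`. The strata are the connected components of the
sets `X j \ X (j - 1)`. -/
structure IsAlgebraicStratification {𝕜 : Type*} [RCLike 𝕜] {n : ℕ}
    (𝒮 : Set (Set (ProjSpace 𝕜 n))) : Prop extends IsStratification 𝒮 where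
  exists_filtration : ∃ X : ℤ → Set (ProjSpace 𝕜 n), X (-1) = ∅ ∧ X n = univ ∧
    (∀ j : ℕ, j ≤ n → IsProjAlgebraic (X j) ∧ X (j - 1) ⊆ X j ∧
      (projDim (X j) = ((finrank ℝ 𝕜 * j : ℕ) : WithBot ℕ∞) ∨ X j = X (j - 1)) ∧
      ∀ x ∈ X j, ¬ IsNonsingularAt (X j) x → x ∈ X (j - 1)) ∧
    ∀ S : Set (ProjSpace 𝕜 n), S ∈ 𝒮 ↔ ∃ j : ℕ, j ≤ n ∧ ∃ x ∈ X j \ X (j - 1),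
      projEmb '' S = connectedComponentIn (projEmb '' (X j \ X (j - 1))) (projEmb x)

/-! ### Stratified submersive families of diffeomorphisms -/

/-- `Ψ` restricts to a submersive family of diffeomorphisms `U × S → S` of the submanifold `S` of
`ℙⁿ`, with parameters in the open set `U` of `𝕜 ^ (n + 1)`. -/
structure IsSubmersiveFamily {𝕜 : Type*} [RCLike 𝕜] {n : ℕ} (U : Set (Fin (n + 1) → 𝕜))
    (S : Set (ProjSpace 𝕜 n)) (Ψ : (Fin (n + 1) → 𝕜) → ProjSpace 𝕜 n → ProjSpace 𝕜 n) :
    Prop where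
  mapsTo : ∀ t ∈ U, MapsTo (Ψ t) S S
  /-- `Ψ : U × S → S` is of class `C¹`. -/
  smooth : ∃ G : (Fin (n + 1) → 𝕜) × MatSpace 𝕜 n → MatSpace 𝕜 n,
    ContDiffOn ℝ 1 G (U ×ˢ (projEmb '' S)) ∧
    ∀ t ∈ U, ∀ x ∈ S, G (t, projEmb x) = projEmb (Ψ t x)
  /-- `Ψ t : S → S` is bijective, with an inverse of class `C¹`. -/
  bijOn : ∀ t ∈ U, BijOn (Ψ t) S S
  smooth_inv : ∀ t ∈ U, ∃ H : MatSpace 𝕜 n → MatSpace 𝕜 n,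
    ContDiffOn ℝ 1 H (projEmb '' S) ∧ ∀ x ∈ S, H (projEmb (Ψ t x)) = projEmb x
  /-- The differential at `t` of the orbit map `τ ↦ Ψ τ x` is onto the tangent space of `S`. -/
  submersive : ∀ t ∈ U, ∀ x ∈ S,
    LinearMap.range (fderiv ℝ (fun τ => projEmb (Ψ τ x)) t : (Fin (n + 1) → 𝕜) →ₗ[ℝ] MatSpace 𝕜 n) =
      tangentSpaceOf (projEmb '' S) (projEmb (Ψ t x))

/-- The map `Ψ : U × ℙⁿ → ℙⁿ` is semialgebraic: its graph is. -/
def IsSemialgebraicFamily {𝕜 : Type*} [RCLike 𝕜] {n : ℕ} (U : Set (Fin (n + 1) → 𝕜))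
    (Ψ : (Fin (n + 1) → 𝕜) → ProjSpace 𝕜 n → ProjSpace 𝕜 n) : Prop :=
  IsSemialgebraic {p : (Fin (n + 1) → 𝕜) × MatSpace 𝕜 n × MatSpace 𝕜 n |
    p.1 ∈ U ∧ ∃ x, p.2.1 = projEmb x ∧ p.2.2 = projEmb (Ψ p.1 x)}

end

/-!
Fix a stratum `S` of dimension `d` and consider the incidence set of the triples `(x, y, t)` with
`y = Ψ t x`, `x ∈ Z ∩ S` and `y ∈ W ∩ S`. Its fibre over `(x, y)` is a level set of the orbit map
`τ ↦ Ψ τ x`, a submersion onto `S`, so the fibre has codimension at least `d` in the parameter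
space `P`, and the incidence set has dimension at most `dim (Z ∩ S) + dim (W ∩ S) + dim P - d`. Its
fibre over `t` is a copy of `Z ∩ Ψ t ⁻¹' W ∩ S`. If the parameters for which this fibre has more
than the expected dimension were Zariski dense in `P`, the incidence set would be too big; so they
lie in a proper hypersurface, and it suffices to remove one hypersurface for each of the finitely
many strata.

No semialgebraic cell decomposition is needed. The dimension of a set, being a Krull dimension, is
the largest number of linear forms that are algebraically independent on it, and this bounds the
dimension from below by that of the fibres over a Zariski dense set of parameters. For the upper
bound, a semialgebraic set is a finite union of pieces, each open in an algebraic set. On an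
irreducible piece, elimination of one variable at a time shows that the projection to a family of
algebraically independent coordinates has nonempty interior; choosing the family, by matroid
exchange, to extend a maximal independent family on the base produces a fibre with as many
independent coordinates as the dimensions predict. The dimension of the level sets is controlled
through their Hausdorff dimension.
-/

section AlgebraicIndependence

theorem ringKrullDim_eq_of_isIntegral_of_injective {R S : Type*} [CommRing R] [CommRing S]
    [Algebra R S] [Algebra.IsIntegral R S] (hinj : Function.Injective (algebraMap R S)) :
    ringKrullDim S = ringKrullDim R := by
  apply le_antisymm
  · exact Order.krullDim_le_of_strictMono (PrimeSpectrum.comap (algebraMap R S))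
      fun I J hIJ => Ideal.IsIntegral.comap_lt_comap (I := I.asIdeal) (J := J.asIdeal) hIJ
  · refine iSup_le fun l => ?_
    have hker : RingHom.ker (algebraMap R S) ≤ (RelSeries.head l).asIdeal := by
      simp [(RingHom.injective_iff_ker_eq_bot _).1 hinj]
    obtain ⟨Q, -, hQ, hQl⟩ := Ideal.exists_ideal_over_prime_of_isIntegral (S := S)
      (RelSeries.head l).asIdeal ⊥ hker
    have : Q.LiesOver (RelSeries.head l).asIdeal := ⟨hQl.symm⟩
    obtain ⟨L, hL, -⟩ := Ideal.exists_ltSeries_of_hasGoingUp l Q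
    rw [← hL]
    exact Order.LTSeries.length_le_krullDim L

variable {k R κ ι : Type*} [Field k] [CommRing R] [Algebra k R]

theorem exists_isIntegral_mvPolynomial_ringKrullDim_eq (k R : Type*) [Field k] [CommRing R]
    [Nontrivial R] [Algebra k R] [Algebra.FiniteType k R] :
    ∃ (s : ℕ) (g : MvPolynomial (Fin s) k →ₐ[k] R), Function.Injective g ∧ g.IsIntegral ∧
      ringKrullDim R = s := by
  obtain ⟨s, g, hg, hi⟩ := exists_integral_inj_algHom_of_fg k R
  refine ⟨s, g, hg, hi, ?_⟩
  algebraize [g.toRingHom]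
  have : Algebra.IsIntegral (MvPolynomial (Fin s) k) R := ⟨hi⟩
  simp [ringKrullDim_eq_of_isIntegral_of_injective (R := MvPolynomial (Fin s) k) (S := R) hg]

theorem exists_isPrime_algebraicIndependent_quotientMk {y : κ → R}
    (hy : AlgebraicIndependent k y) :
    ∃ q : Ideal R, q.IsPrime ∧ AlgebraicIndependent k (Ideal.Quotient.mkₐ k q ∘ y) := by
  let M : Submonoid R := (nonZeroDivisors (MvPolynomial κ k)).map (MvPolynomial.aeval y)
  have hM : Disjoint ((⊥ : Ideal R) : Set R) M := by
    rw [Set.disjoint_left]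
    rintro _ h0 ⟨p, hp, rfl⟩
    exact nonZeroDivisors.ne_zero hp (hy (by simpa using h0))
  obtain ⟨q, hq, -, hqM⟩ := Ideal.exists_le_prime_disjoint _ _ hM
  refine ⟨q, hq, algebraicIndependent_iff.2 fun p hp => ?_⟩
  by_contra hp0
  have hpq : Ideal.Quotient.mkₐ k q (MvPolynomial.aeval y p) = 0 :=
    (MvPolynomial.comp_aeval_apply ..).trans hp
  rw [Ideal.Quotient.mkₐ_eq_mk, Ideal.Quotient.eq_zero_iff_mem] at hpq
  exact Set.disjoint_left.1 hqM hpq ⟨p, mem_nonZeroDivisors_of_ne_zero hp0, rfl⟩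

theorem trdeg_le_of_isIntegral_mvPolynomial [IsDomain R] {s : ℕ}
    (g : MvPolynomial (Fin s) k →ₐ[k] R) (hg : g.IsIntegral) : Algebra.trdeg k R ≤ s := by
  have hrange : g.range = Algebra.adjoin k (range fun i => g (MvPolynomial.X i)) := by
    rw [Algebra.adjoin_range_eq_range_aeval]
    exact congrArg AlgHom.range (MvPolynomial.aeval_unique g)
  have : Algebra.IsIntegral (Algebra.adjoin k (range fun i => g (MvPolynomial.X i))) R := by
    rw [← hrange]
    exact ⟨RingHom.IsIntegral.tower_top g.rangeRestrict.toRingHom (algebraMap g.range R) hg⟩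
  refine (Algebra.IsAlgebraic.trdeg_le_cardinalMk k (range fun i => g (MvPolynomial.X i))).trans ?_
  simpa using Cardinal.mk_range_le_lift (f := fun i => g (MvPolynomial.X i))

theorem le_ringKrullDim_of_algebraicIndependent [Algebra.FiniteType k R] {d : ℕ} {y : Fin d → R}
    (hy : AlgebraicIndependent k y) : (d : WithBot ℕ∞) ≤ ringKrullDim R := by
  have : Nontrivial R := hy.algebraMap_injective.nontrivial
  obtain ⟨s, g, -, hg, hs⟩ := exists_isIntegral_mvPolynomial_ringKrullDim_eq k R
  obtain ⟨q, hq, hyq⟩ := exists_isPrime_algebraicIndependent_quotientMk hy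
  have hgq : ((Ideal.Quotient.mkₐ k q).comp g).IsIntegral :=
    RingHom.IsIntegral.trans g.toRingHom (Ideal.Quotient.mk q) hg
      (RingHom.isIntegral_of_surjective _ Ideal.Quotient.mk_surjective)
  have hds : d ≤ s := by
    simpa using hyq.lift_cardinalMk_le_trdeg.trans
      (Cardinal.lift_le.2 (trdeg_le_of_isIntegral_mvPolynomial _ hgq))
  rw [hs]
  exact_mod_cast hds

theorem exists_algebraicIndependent_comp_of_adjoin_eq_top [Finite ι] {x : ι → R}
    (hx : Algebra.adjoin k (range x) = ⊤) {d : ℕ} {y : Fin d → R}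
    (hy : AlgebraicIndependent k y) : ∃ f : Fin d → ι, AlgebraicIndependent k (x ∘ f) := by
  obtain ⟨q, hq, hyq⟩ := exists_isPrime_algebraicIndependent_quotientMk hy
  let π := Ideal.Quotient.mkₐ k q
  have hπx : Algebra.adjoin k (range (π ∘ x)) = ⊤ := by
    rw [range_comp, ← AlgHom.map_adjoin, hx, Algebra.map_top]
    exact (AlgHom.range_eq_top _).2 (Ideal.Quotient.mkₐ_surjective k q)
  have : Algebra.IsAlgebraic (Algebra.adjoin k (range (π ∘ x))) (R ⧸ q) :=
    ⟨fun a => isAlgebraic_algebraMap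
      (⟨a, hπx ▸ Algebra.mem_top⟩ : Algebra.adjoin k (range (π ∘ x)))⟩
  obtain ⟨t, ht, htb⟩ := exists_isTranscendenceBasis_subset (R := k) (range (π ∘ x))
  have : Finite t := (finite_range (π ∘ x)).subset ht
  have hdt : d ≤ Nat.card t := by
    have h := hyq.lift_cardinalMk_le_trdeg
    rw [← htb.cardinalMk_eq_trdeg, ← Nat.cast_card (α := t)] at h
    simpa only [Cardinal.mk_fin, Cardinal.lift_natCast, Nat.cast_le] using h
  choose σ hσ using fun a : t => ht a.2
  let e : Fin d → t := fun i => (Finite.equivFin t).symm (Fin.castLE hdt i)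
  have he : Function.Injective e :=
    (Finite.equivFin t).symm.injective.comp (Fin.castLE_injective hdt)
  refine ⟨σ ∘ e, AlgebraicIndependent.of_comp π ?_⟩
  have hσe : π ∘ x ∘ σ ∘ e = Subtype.val ∘ e := funext fun i => hσ (e i)
  rw [hσe]
  exact htb.1.comp _ he

theorem natCast_le_ringKrullDim_iff [Finite ι] {x : ι → R}
    (hx : Algebra.adjoin k (range x) = ⊤) {d : ℕ} :
    (d : WithBot ℕ∞) ≤ ringKrullDim R ↔ ∃ f : Fin d → ι, AlgebraicIndependent k (x ∘ f) := by
  have : Algebra.FiniteType k R := ⟨hx ▸ ⟨(finite_range x).toFinset, by simp⟩⟩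
  refine ⟨fun hd => ?_, fun ⟨f, hf⟩ => le_ringKrullDim_of_algebraicIndependent hf⟩
  rcases subsingleton_or_nontrivial R with _ | _
  · simp [ringKrullDim_eq_bot_of_subsingleton] at hd
  obtain ⟨s, g, hg, -, hs⟩ := exists_isIntegral_mvPolynomial_ringKrullDim_eq k R
  have hds : d ≤ s := by exact_mod_cast hs ▸ hd
  have hX : AlgebraicIndependent k (MvPolynomial.X ∘ Fin.castLE hds : Fin d → MvPolynomial _ k) :=
    (MvPolynomial.algebraicIndependent_X (Fin s) k).comp _ (Fin.castLE_injective hds)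
  exact exists_algebraicIndependent_comp_of_adjoin_eq_top hx (hX.map' hg)

end AlgebraicIndependence

/-- A set of points of affine space is Zariski dense if no nonzero polynomial vanishes on it. -/
def ZariskiDense {K κ : Type*} [Field K] (T : Set (κ → K)) : Prop :=
  ∀ p : MvPolynomial κ K, (∀ x ∈ T, MvPolynomial.eval x p = 0) → p = 0

namespace ZariskiDense

open MvPolynomial

variable {K κ τ : Type*} [Field K]

theorem mono {S T : Set (κ → K)} (hS : ZariskiDense S) (h : S ⊆ T) : ZariskiDense T :=
  fun p hp => hS p fun x hx => hp x (h hx)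

theorem nonempty {S : Set (κ → K)} (hS : ZariskiDense S) : S.Nonempty := by
  by_contra! h
  exact one_ne_zero (hS 1 (by simp [h]))

theorem of_isEmpty [IsEmpty κ] {S : Set (κ → K)} (hS : S.Nonempty) : ZariskiDense S := by
  obtain ⟨a, ha⟩ := hS
  intro p hp
  have hpa := hp a ha
  rw [eq_C_of_isEmpty p] at hpa ⊢
  simpa using hpa

theorem exists_of_subset_iUnion {α : Type*} [Finite α] {S : Set (κ → K)} (hS : ZariskiDense S)
    {T : α → Set (κ → K)} (hT : S ⊆ ⋃ i, T i) : ∃ i, ZariskiDense (T i) := by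
  cases nonempty_fintype α
  by_contra! h
  simp only [ZariskiDense, not_forall] at h
  choose p hp hp0 using h
  refine Finset.prod_ne_zero_iff.2 (fun i _ => hp0 i) (hS (∏ i, p i) fun x hx => ?_)
  obtain ⟨i, hi⟩ := mem_iUnion.1 (hT hx)
  rw [map_prod]
  exact Finset.prod_eq_zero (Finset.mem_univ i) (hp i x hi)

theorem image_comp {S : Set (κ → K)} (hS : ZariskiDense S) {g : τ → κ}
    (hg : Function.Injective g) : ZariskiDense ((fun a : κ → K => a ∘ g) '' S) := by
  refine fun p hp => rename_injective g hg ?_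
  rw [map_zero]
  refine hS _ fun x hx => ?_
  rw [eval_rename]
  exact hp _ ⟨x, hx, rfl⟩

theorem of_fibers {M : Set (κ ⊕ τ → K)} {B : Set (τ → K)} (hB : ZariskiDense B)
    (hM : ∀ t ∈ B, ZariskiDense {y : κ → K | Sum.elim y t ∈ M}) : ZariskiDense M := by
  intro p hp
  have heval (y : κ → K) (t : τ → K) :
      eval y (map (eval t) (sumRingEquiv K κ τ p)) = eval (Sum.elim y t) p := by
    have : ((eval y).comp (map (eval t))).comp (sumRingEquiv K κ τ : MvPolynomial (κ ⊕ τ) K →+* _)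
        = eval (Sum.elim y t) := by
      refine ringHom_ext (fun r => by simp [sumRingEquiv_C]) ?_
      rintro (i | i)
      · simp [sumRingEquiv_X_inl]
      · simp [sumRingEquiv_X_inr]
    exact congrArg (fun h => h p) this
  apply (sumRingEquiv K κ τ).injective
  rw [map_zero]
  ext1 m
  rw [coeff_zero]
  refine hB _ fun t ht => ?_
  have h0 : map (eval t) (sumRingEquiv K κ τ p) = 0 :=
    hM t ht _ fun y hy => (heval y t).trans (hp _ hy)
  rw [← coeff_map, h0, coeff_zero]

theorem of_interior_nonempty [Finite κ] {S : Set (κ → ℝ)} (hS : (interior S).Nonempty) :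
    ZariskiDense S := by
  cases nonempty_fintype κ
  obtain ⟨x, hx⟩ := hS
  obtain ⟨ε, hε, hball⟩ := Metric.isOpen_iff.1 isOpen_interior x hx
  intro p hp
  refine MvPolynomial.funext_set (fun i => Metric.ball (x i) ε) (fun i => ?_) fun y hy => ?_
  · exact infinite_of_mem_nhds (x i) (Metric.ball_mem_nhds _ hε)
  · rw [map_zero]
    refine hp y (interior_subset (hball ?_))
    rwa [ball_pi _ hε]

theorem image_iff_algebraicIndependent {X : Type*} {A : Set X} {x : κ → X → K} :
    ZariskiDense ((fun a i => x i a) '' A) ↔ AlgebraicIndependent K fun i (a : A) => x i a := by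
  rw [algebraicIndependent_iff]
  refine forall_congr' fun p => imp_congr_left ?_
  simp only [funext_iff, forall_mem_image, Subtype.forall, Pi.zero_apply]
  refine forall₂_congr fun a ha => ?_
  have h : aeval (fun i (a : A) => x i a) p ⟨a, ha⟩ = aeval (fun i => x i a) p :=
    comp_aeval_apply (φ := Pi.evalAlgHom K (fun _ : A => K) ⟨a, ha⟩) ..
  rw [h]
  rfl

theorem injective {X : Type*} {A : Set X} {x : κ → X → K}
    (h : ZariskiDense ((fun a i => x i a) '' A)) : Function.Injective x :=
  fun _ _ hij => (image_iff_algebraicIndependent.1 h).injective (by simp only [hij])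

end ZariskiDense

section SemialgDim

variable {E F : Type*} [AddCommGroup E] [Module ℝ E] [AddCommGroup F] [Module ℝ F]

theorem polyFunctionsOn_eq_adjoin {ι : Type*} {x : ι → Dual ℝ E}
    (hx : Submodule.span ℝ (range x) = ⊤) (A : Set E) :
    polyFunctionsOn A = Algebra.adjoin ℝ (range fun i (a : A) => x i a) := by
  apply le_antisymm <;> refine Algebra.adjoin_le ?_ <;> rintro _ ⟨l, rfl⟩
  · let r : Dual ℝ E →ₗ[ℝ] A → ℝ :=
      { toFun := fun l a => l a, map_add' := fun _ _ => rfl, map_smul' := fun _ _ => rfl }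
    have hr : Submodule.span ℝ (range x) ≤
        (Algebra.adjoin ℝ (range fun i (a : A) => x i a)).toSubmodule.comap r := by
      rw [Submodule.span_le]
      rintro _ ⟨i, rfl⟩
      exact Algebra.subset_adjoin ⟨i, rfl⟩
    exact hr (hx ▸ Submodule.mem_top)
  · exact Algebra.subset_adjoin ⟨x l, rfl⟩

theorem natCast_le_semialgDim_iff_of_span {ι : Type*} [Finite ι] {x : ι → Dual ℝ E}
    (hx : Submodule.span ℝ (range x) = ⊤) {A : Set E} {d : ℕ} :
    (d : WithBot ℕ∞) ≤ semialgDim A ↔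
      ∃ f : Fin d → ι, ZariskiDense ((fun a i => x (f i) a) '' A) := by
  let y : ι → polyFunctionsOn A := fun i => ⟨fun a => x i a, Algebra.subset_adjoin ⟨x i, rfl⟩⟩
  have hy : Algebra.adjoin ℝ (range y) = ⊤ := by
    apply Subalgebra.map_injective (f := (polyFunctionsOn A).val) Subtype.val_injective
    rw [AlgHom.map_adjoin, ← range_comp, Algebra.map_top, Subalgebra.range_val]
    exact (polyFunctionsOn_eq_adjoin hx A).symm
  rw [semialgDim, natCast_le_ringKrullDim_iff hy]
  refine exists_congr fun f => ?_
  rw [ZariskiDense.image_iff_algebraicIndependent]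
  exact (AlgHom.algebraicIndependent_iff (polyFunctionsOn A).val Subtype.val_injective).symm

theorem span_range_basisCoord {ι : Type*} [Finite ι] (b : Basis ι ℝ E) :
    Submodule.span ℝ (range b.coord) = ⊤ := by
  classical
  rw [← b.coe_dualBasis, b.dualBasis.span_eq]

theorem natCast_le_semialgDim_pi_iff {ι : Type*} [Finite ι] {A : Set (ι → ℝ)} {d : ℕ} :
    (d : WithBot ℕ∞) ≤ semialgDim A ↔
      ∃ f : Fin d → ι, ZariskiDense ((fun a => a ∘ f) '' A) :=
  natCast_le_semialgDim_iff_of_span (span_range_basisCoord (Pi.basisFun ℝ ι))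

theorem semialgDim_empty : semialgDim (∅ : Set E) = ⊥ := by
  have : Subsingleton (polyFunctionsOn (∅ : Set E)) :=
    ⟨fun f g => Subtype.ext (funext fun a => a.2.elim)⟩
  exact ringKrullDim_eq_bot_of_subsingleton

theorem le_of_forall_natCast_le {a b : WithBot ℕ∞} (h : ∀ d : ℕ, d ≤ a → d ≤ b) : a ≤ b := by
  cases a with
  | bot => exact bot_le
  | coe a =>
    cases b with
    | bot => simpa using h 0 (WithBot.coe_le_coe.2 zero_le)
    | coe b =>
      exact WithBot.coe_le_coe.2 (ENat.forall_natCast_le_iff_le.1 fun d hd =>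
        WithBot.coe_le_coe.1 (h d (WithBot.coe_le_coe.2 hd)))

variable [FiniteDimensional ℝ E] [FiniteDimensional ℝ F]

instance finiteType_polyFunctionsOn (A : Set E) : Algebra.FiniteType ℝ (polyFunctionsOn A) := by
  rw [← Subalgebra.fg_iff_finiteType, Subalgebra.fg_def]
  exact ⟨_, finite_range _,
    (polyFunctionsOn_eq_adjoin (span_range_basisCoord (finBasis ℝ E)) A).symm⟩

theorem natCard_le_semialgDim {κ : Type*} [Finite κ] {A : Set E} (L : E →ₗ[ℝ] (κ → ℝ))
    (h : ZariskiDense (L '' A)) : (Nat.card κ : WithBot ℕ∞) ≤ semialgDim A := by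
  let y : κ → polyFunctionsOn A :=
    fun i => ⟨fun a => L a i, Algebra.subset_adjoin ⟨LinearMap.proj i ∘ₗ L, rfl⟩⟩
  have hy : AlgebraicIndependent ℝ y :=
    (AlgHom.algebraicIndependent_iff (polyFunctionsOn A).val Subtype.val_injective).1
      (ZariskiDense.image_iff_algebraicIndependent (x := fun i a => L a i).1 h)
  exact le_ringKrullDim_of_algebraicIndependent
    (hy.comp (Finite.equivFin κ).symm (Finite.equivFin κ).symm.injective)

theorem natCast_le_semialgDim_iff {A : Set E} {d : ℕ} :
    (d : WithBot ℕ∞) ≤ semialgDim A ↔ ∃ L : E →ₗ[ℝ] (Fin d → ℝ), ZariskiDense (L '' A) := by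
  refine ⟨fun hd => ?_, fun ⟨L, hL⟩ => by simpa using natCard_le_semialgDim L hL⟩
  obtain ⟨f, hf⟩ := (natCast_le_semialgDim_iff_of_span (span_range_basisCoord (finBasis ℝ E))).1 hd
  exact ⟨LinearMap.pi fun i => (finBasis ℝ E).coord (f i), hf⟩

theorem semialgDim_image_le (L : E →ₗ[ℝ] F) (A : Set E) : semialgDim (L '' A) ≤ semialgDim A := by
  refine le_of_forall_natCast_le fun d hd => ?_
  obtain ⟨M, hM⟩ := natCast_le_semialgDim_iff.1 hd
  exact natCast_le_semialgDim_iff.2 ⟨M ∘ₗ L, by rwa [LinearMap.coe_comp, image_comp]⟩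

theorem semialgDim_image_equiv (e : E ≃ₗ[ℝ] F) (A : Set E) :
    semialgDim (e '' A) = semialgDim A := by
  refine le_antisymm (semialgDim_image_le e.toLinearMap A) ?_
  simpa [image_image] using semialgDim_image_le e.symm.toLinearMap (e '' A)

theorem semialgDim_mono {A B : Set E} (h : A ⊆ B) : semialgDim A ≤ semialgDim B := by
  refine le_of_forall_natCast_le fun d hd => ?_
  obtain ⟨L, hL⟩ := natCast_le_semialgDim_iff.1 hd
  exact natCast_le_semialgDim_iff.2 ⟨L, hL.mono (image_mono h)⟩

theorem semialgDim_le_finrank (A : Set E) : semialgDim A ≤ finrank ℝ E := by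
  refine le_of_forall_natCast_le fun d hd => ?_
  obtain ⟨f, hf⟩ := (natCast_le_semialgDim_iff_of_span (span_range_basisCoord (finBasis ℝ E))).1 hd
  have hinj : Function.Injective f := fun i j hij => hf.injective (by simp only [hij])
  simpa using Fintype.card_le_of_injective f hinj

theorem semialgDim_nonneg {A : Set E} (hA : A.Nonempty) : 0 ≤ semialgDim A :=
  natCast_le_semialgDim_iff.2 ⟨0, .of_isEmpty (hA.image _)⟩

theorem exists_semialgDim_eq_natCast {A : Set E} (hA : A.Nonempty) :
    ∃ d : ℕ, semialgDim A = d := by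
  obtain ⟨a, ha⟩ := WithBot.ne_bot_iff_exists.1
    ((WithBot.bot_lt_coe (0 : ℕ∞)).trans_le (semialgDim_nonneg hA)).ne'
  have hle : (a : WithBot ℕ∞) ≤ (finrank ℝ E : ℕ∞) := ha ▸ semialgDim_le_finrank A
  obtain ⟨d, hd⟩ := ENat.ne_top_iff_exists.1
    ((WithBot.coe_le_coe.1 hle).trans_lt (ENat.natCast_lt_top _)).ne
  exact ⟨d, by rw [← ha, ← hd]; rfl⟩

theorem semialgDim_prod_le (A : Set E) (B : Set F) :
    semialgDim (A ×ˢ B) ≤ semialgDim A + semialgDim B := by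
  refine le_of_forall_natCast_le fun d hd => ?_
  obtain ⟨f, hf⟩ := (natCast_le_semialgDim_iff_of_span
    (span_range_basisCoord ((finBasis ℝ E).prod (finBasis ℝ F)))).1 hd
  let l := {i : Fin d // (f i).isLeft}
  let r := {i : Fin d // ¬ (f i).isLeft}
  have hl : (Nat.card l : WithBot ℕ∞) ≤ semialgDim A := by
    refine natCard_le_semialgDim (.pi fun i : l => (finBasis ℝ E).coord ((f i).getLeft i.2)) ?_
    refine (hf.image_comp (g := ((↑) : l → Fin d)) Subtype.val_injective).mono ?_
    rintro _ ⟨_, ⟨⟨a, b⟩, hab, rfl⟩, rfl⟩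
    refine ⟨a, hab.1, funext fun ⟨i, hi⟩ => ?_⟩
    obtain ⟨j, hj⟩ := Sum.isLeft_iff.1 hi
    simp [hj]
  have hr : (Nat.card r : WithBot ℕ∞) ≤ semialgDim B := by
    refine natCard_le_semialgDim
      (.pi fun i : r => (finBasis ℝ F).coord ((f i).getRight (Sum.not_isLeft.1 i.2))) ?_
    refine (hf.image_comp (g := ((↑) : r → Fin d)) Subtype.val_injective).mono ?_
    rintro _ ⟨_, ⟨⟨a, b⟩, hab, rfl⟩, rfl⟩
    refine ⟨b, hab.2, funext fun ⟨i, hi⟩ => ?_⟩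
    obtain ⟨j, hj⟩ := Sum.isRight_iff.1 (Sum.not_isLeft.1 hi)
    simp [hj]
  have hlr : Nat.card l + Nat.card r = d := by
    rw [← Nat.card_sum, Nat.card_congr (Equiv.sumCompl fun i : Fin d => ((f i).isLeft : Prop)),
      Nat.card_fin]
  rw [← hlr, Nat.cast_add]
  exact add_le_add hl hr

theorem semialgDim_singleton_le (x : E) : semialgDim {x} ≤ 0 := by
  refine le_of_forall_natCast_le fun d hd => ?_
  obtain ⟨L, hL⟩ := natCast_le_semialgDim_iff.1 hd
  suffices d = 0 by simp [this]
  by_contra h0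
  let i : Fin d := ⟨0, Nat.pos_of_ne_zero h0⟩
  have h : MvPolynomial.X i - MvPolynomial.C (L x i) = (0 : MvPolynomial (Fin d) ℝ) :=
    hL _ (by simp)
  simpa using congrArg (MvPolynomial.eval fun _ => L x i + 1) h

theorem natCast_add_le_semialgDim {k m : ℕ} {M : Set (E × F)}
    (h : m ≤ semialgDim {y | k ≤ semialgDim {x | (x, y) ∈ M}}) :
    ((k + m : ℕ) : WithBot ℕ∞) ≤ semialgDim M := by
  obtain ⟨L, hL⟩ := natCast_le_semialgDim_iff.1 h
  let b := finBasis ℝ E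
  let T (f : Fin k → Fin (finrank ℝ E)) : Set F :=
    {y | ZariskiDense ((fun a i => b.coord (f i) a) '' {x | (x, y) ∈ M})}
  have hT : L '' {y | (k : WithBot ℕ∞) ≤ semialgDim {x | (x, y) ∈ M}} ⊆ ⋃ f, L '' T f := by
    rw [← image_iUnion]
    refine image_mono fun y hy => mem_iUnion.2 ?_
    exact (natCast_le_semialgDim_iff_of_span (span_range_basisCoord b)).1 hy
  obtain ⟨f, hf⟩ := hL.exists_of_subset_iUnion hT
  let L' : E × F →ₗ[ℝ] (Fin k ⊕ Fin m → ℝ) := LinearMap.pi <| Sum.elim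
    (fun i => b.coord (f i) ∘ₗ LinearMap.fst ℝ E F)
    (fun i => LinearMap.proj i ∘ₗ L ∘ₗ LinearMap.snd ℝ E F)
  have hL' : ZariskiDense (L' '' M) := by
    refine .of_fibers hf ?_
    rintro _ ⟨y, hy, rfl⟩
    refine ZariskiDense.mono hy ?_
    rintro _ ⟨x, hx, rfl⟩
    refine ⟨(x, y), hx, funext ?_⟩
    rintro (i | i) <;> rfl
  simpa using natCard_le_semialgDim L' hL'

end SemialgDim

section Elimination

open scoped Polynomial
open Polynomial (C X)

variable {R : Type*} [CommRing R] {q : Ideal R[X]} {F G : R[X]}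

theorem eraseLead_mem_of_C_leadingCoeff_mem (hF : F ∈ q) (hlc : C F.leadingCoeff ∈ q) :
    F.eraseLead ∈ q := by
  rw [← Polynomial.self_sub_monomial_natDegree_leadingCoeff, ← Polynomial.C_mul_X_pow_eq_monomial]
  exact q.sub_mem hF (q.mul_mem_right _ hlc)

theorem mem_map_C_of_forall_C_leadingCoeff_mem (h : ∀ F ∈ q, C F.leadingCoeff ∈ q)
    (hF : F ∈ q) : F ∈ (q.comap C).map C := by
  induction hd : F.degree using WellFoundedLT.induction generalizing F with
  | ind d ih =>
    subst hd
    rcases eq_or_ne F 0 with rfl | hF0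
    · exact zero_mem _
    rw [← F.eraseLead_add_C_mul_X_pow]
    exact add_mem (ih _ (Polynomial.degree_eraseLead_lt hF0)
        (eraseLead_mem_of_C_leadingCoeff_mem hF (h F hF)) rfl)
      (Ideal.mul_mem_right _ _ (Ideal.mem_map_of_mem C (h F hF)))

theorem degree_C_leadingCoeff_mul_sub_lt (hG : G ≠ 0) (h : F.natDegree ≤ G.natDegree) :
    (C F.leadingCoeff * G - C G.leadingCoeff * X ^ (G.natDegree - F.natDegree) * F).degree
      < G.degree := by
  rw [Polynomial.degree_eq_natDegree hG, Polynomial.degree_lt_iff_coeff_zero]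
  intro m hm
  rw [Polynomial.coeff_sub, Polynomial.coeff_C_mul, mul_assoc, Polynomial.coeff_C_mul,
    Polynomial.coeff_X_pow_mul', if_pos (by omega)]
  rcases hm.eq_or_lt with rfl | hlt
  · rw [Nat.sub_sub_self h, Polynomial.coeff_natDegree, Polynomial.coeff_natDegree]
    ring
  · rw [Polynomial.coeff_eq_zero_of_natDegree_lt hlt,
      Polynomial.coeff_eq_zero_of_natDegree_lt (p := F) (by omega)]
    ring

theorem exists_C_leadingCoeff_pow_mul_mem (hF : F ∈ q)
    (hmin : ∀ G ∈ q, C G.leadingCoeff ∉ q → F.natDegree ≤ G.natDegree) (hG : G ∈ q) :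
    ∃ N : ℕ, C F.leadingCoeff ^ N * G ∈ Ideal.span {F} ⊔ (q.comap C).map C := by
  induction hd : G.degree using WellFoundedLT.induction generalizing G with
  | ind d ih =>
    subst hd
    rcases eq_or_ne G 0 with rfl | hG0
    · exact ⟨0, by simp⟩
    by_cases hlc : C G.leadingCoeff ∈ q
    · obtain ⟨N, hN⟩ := ih _ (Polynomial.degree_eraseLead_lt hG0)
        (eraseLead_mem_of_C_leadingCoeff_mem hG hlc) rfl
      refine ⟨N, ?_⟩
      rw [← G.eraseLead_add_C_mul_X_pow, mul_add]
      exact add_mem hN (Ideal.mul_mem_left _ _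
        (Ideal.mul_mem_right _ _ (Ideal.mem_sup_right (Ideal.mem_map_of_mem C hlc))))
    · obtain ⟨N, hN⟩ := ih _ (degree_C_leadingCoeff_mul_sub_lt hG0 (hmin G hG hlc))
        (q.sub_mem (q.mul_mem_left _ hG) (q.mul_mem_left _ hF)) rfl
      refine ⟨N + 1, ?_⟩
      rw [mul_sub, ← mul_assoc, ← pow_succ] at hN
      refine (Submodule.sub_mem_iff_left _ ?_).1 hN
      exact Ideal.mul_mem_left _ _ (Ideal.mul_mem_left _ _
        (Ideal.mem_sup_left (Ideal.mem_span_singleton_self F)))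

theorem derivative_notMem_of_forall_natDegree_le [Algebra ℚ R] [q.IsPrime] (hF : F ∈ q)
    (hlc : C F.leadingCoeff ∉ q)
    (hmin : ∀ G ∈ q, C G.leadingCoeff ∉ q → F.natDegree ≤ G.natDegree) :
    Polynomial.derivative F ∉ q := by
  have : IsAddTorsionFree R := .of_module_rat R
  intro hder
  have hdeg : F.natDegree ≠ 0 := fun h0 => by
    rw [Polynomial.eq_C_of_natDegree_eq_zero h0] at hF hlc
    rw [Polynomial.leadingCoeff_C] at hlc
    exact hlc hF
  have hlcder : C (Polynomial.derivative F).leadingCoeff ∈ q := by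
    by_contra hn
    exact (hmin _ hder hn).not_gt (Polynomial.natDegree_derivative_lt hdeg)
  have hunit : IsUnit (C (F.natDegree : R)) := by
    have h := ((IsUnit.mk0 (F.natDegree : ℚ) (Nat.cast_ne_zero.2 hdeg)).map
      (algebraMap ℚ R)).map C
    rwa [map_natCast] at h
  rw [Polynomial.leadingCoeff_derivative, C.map_mul] at hlcder
  exact hlc ((‹q.IsPrime›.mem_or_mem hlcder).resolve_right fun h =>
    ‹q.IsPrime›.ne_top (Ideal.eq_top_of_isUnit_mem _ h hunit))

end Elimination

section SimpleZero

theorem eventually_neg_and_pos_of_hasDerivAt {g : ℝ → ℝ} {c θ : ℝ} (hg : HasDerivAt g c θ)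
    (hθ : g θ = 0) (hc : 0 < c) : ∀ᶠ ε in 𝓝[>] 0, g (θ - ε) < 0 ∧ 0 < g (θ + ε) := by
  have hsign := eventually_nhdsWithin_sign_eq_of_deriv_pos (hg.deriv ▸ hc) hθ
  have hsub : Filter.Tendsto (fun ε : ℝ => θ - ε) (𝓝[>] 0) (𝓝 θ) :=
    (Continuous.tendsto' (by fun_prop) _ _ (by simp)).mono_left nhdsWithin_le_nhds
  have hadd : Filter.Tendsto (fun ε : ℝ => θ + ε) (𝓝[>] 0) (𝓝 θ) :=
    (Continuous.tendsto' (by fun_prop) _ _ (by simp)).mono_left nhdsWithin_le_nhds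
  filter_upwards [hsub.eventually hsign, hadd.eventually hsign, self_mem_nhdsWithin]
    with ε hneg hpos (hε : 0 < ε)
  rw [sub_sub_cancel_left, sign_neg (neg_lt_zero.2 hε), sign_eq_neg_one_iff] at hneg
  rw [add_sub_cancel_left, sign_pos hε, sign_eq_one_iff] at hpos
  exact ⟨hneg, hpos⟩

theorem eventually_exists_zero_of_hasDerivAt {Y : Type*} [TopologicalSpace Y] {f : Y × ℝ → ℝ}
    (hf : Continuous f) {u : Y} {θ c : ℝ} (hd : HasDerivAt (fun η => f (u, η)) c θ)
    (h0 : f (u, θ) = 0) (hc : c ≠ 0) {O : Set (Y × ℝ)} (hO : O ∈ 𝓝 (u, θ)) :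
    ∀ᶠ v in 𝓝 u, ∃ η, (v, η) ∈ O ∧ f (v, η) = 0 := by
  wlog hpos : 0 < c generalizing f c
  · simpa using this hf.neg hd.neg (neg_eq_zero.2 h0) (neg_ne_zero.2 hc)
      (neg_pos.2 (hc.lt_of_le (not_lt.1 hpos)))
  rw [nhds_prod_eq] at hO
  obtain ⟨V, hV, W, hW, hVW⟩ := Filter.mem_prod_iff.1 hO
  obtain ⟨r, hr, hrW⟩ := Metric.mem_nhds_iff.1 hW
  obtain ⟨ε, ⟨hneg, hpos'⟩, hε, hεr⟩ := ((eventually_neg_and_pos_of_hasDerivAt hd h0 hpos).and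
    (Ioo_mem_nhdsGT hr)).exists
  have hcont (η : ℝ) : Continuous fun v => f (v, η) := by fun_prop
  filter_upwards [hV, (hcont _).continuousAt.eventually (gt_mem_nhds hneg),
    (hcont _).continuousAt.eventually (lt_mem_nhds hpos')] with v hvV hv_neg hv_pos
  obtain ⟨η, hη, hη0⟩ := intermediate_value_Icc (by linarith : θ - ε ≤ θ + ε)
    (by fun_prop : Continuous fun η => f (v, η)).continuousOn ⟨hv_neg.le, hv_pos.le⟩
  refine ⟨η, hVW ⟨hvV, hrW ?_⟩, hη0⟩
  rw [← Real.closedBall_eq_Icc] at hη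
  exact Metric.closedBall_subset_ball hεr hη

end SimpleZero

section PrimeProjection

open MvPolynomial
open scoped Polynomial

variable {σ : Type*} {q : Ideal (MvPolynomial σ ℝ)[X]} {u : σ → ℝ}

theorem continuous_eval₂_eval (F : (MvPolynomial σ ℝ)[X]) :
    Continuous fun z : (σ → ℝ) × ℝ => F.eval₂ (eval z.1) z.2 := by
  simp only [Polynomial.eval₂_eq_sum_range]
  exact continuous_finsetSum _ fun i _ =>
    ((continuous_eval _).comp continuous_fst).mul (continuous_snd.pow i)

theorem eval₂_eval_eq_zero_of_mem_map_C (hu : ∀ g ∈ q.comap Polynomial.C, eval u g = 0)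
    {F : (MvPolynomial σ ℝ)[X]} (hF : F ∈ (q.comap Polynomial.C).map Polynomial.C) (θ : ℝ) :
    F.eval₂ (eval u) θ = 0 := by
  have hle : (q.comap Polynomial.C).map Polynomial.C ≤
      RingHom.ker (Polynomial.eval₂RingHom (eval u) θ) :=
    Ideal.map_le_iff_le_comap.2 fun g hg => by simpa using hu g hg
  exact hle hF

-- Let `F ∈ q` have least degree among the elements of `q` whose leading coefficient is not in `q`.
-- Up to a power of that coefficient, `q` is generated by `F` and its elimination ideal, and a zero
-- of `F` that is not a zero of its derivative persists under perturbation of the parameters.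
theorem exists_notMem_forall_eventually_exists_zero (hq : q.IsPrime) :
    ∃ h ∉ q, ∀ u θ, (∀ F ∈ q, F.eval₂ (eval u) θ = 0) → h.eval₂ (eval u) θ ≠ 0 →
      ∀ O ∈ 𝓝 (u, θ), ∀ᶠ v in 𝓝 u, (∀ g ∈ q.comap Polynomial.C, eval v g = 0) →
        ∃ η, (v, η) ∈ O ∧ ∀ F ∈ q, F.eval₂ (eval v) η = 0 := by
  by_cases hlc : ∀ F ∈ q, Polynomial.C F.leadingCoeff ∈ q
  · refine ⟨1, (Ideal.ne_top_iff_one q).1 hq.ne_top, fun u θ _ _ O hO => ?_⟩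
    filter_upwards [(Continuous.prodMk_left θ).continuousAt hO] with v hvO hv
    exact ⟨θ, hvO, fun F hF =>
      eval₂_eval_eq_zero_of_mem_map_C hv (mem_map_C_of_forall_C_leadingCoeff_mem hlc hF) θ⟩
  · push Not at hlc
    obtain ⟨F, ⟨hF, hFlc⟩, hFmin⟩ := (measure Polynomial.natDegree).wf.has_min
      {F | F ∈ q ∧ Polynomial.C F.leadingCoeff ∉ q} hlc
    have hmin : ∀ G ∈ q, Polynomial.C G.leadingCoeff ∉ q → F.natDegree ≤ G.natDegree :=
      fun G hG hG' => not_lt.1 (hFmin G ⟨hG, hG'⟩)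
    refine ⟨Polynomial.C F.leadingCoeff * Polynomial.derivative F, fun hmul =>
      (hq.mem_or_mem hmul).elim hFlc (derivative_notMem_of_forall_natDegree_le hF hFlc hmin),
      fun u θ hu hne O hO => ?_⟩
    rw [Polynomial.eval₂_mul, Polynomial.eval₂_C, mul_ne_zero_iff] at hne
    have hderiv : HasDerivAt (fun η => F.eval₂ (eval u) η)
        ((Polynomial.derivative F).eval₂ (eval u) θ) θ := by
      simpa only [Polynomial.eval₂_eq_eval_map, Polynomial.derivative_map] using
        (F.map (eval u)).hasDerivAt θ
    filter_upwards [eventually_exists_zero_of_hasDerivAt (continuous_eval₂_eval F) hderiv (hu F hF)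
      hne.2 hO, (continuous_eval _).continuousAt.eventually_ne hne.1] with v ⟨η, hηO, hη⟩ hvlc hv
    refine ⟨η, hηO, fun G hG => ?_⟩
    obtain ⟨N, hN⟩ := exists_C_leadingCoeff_pow_mul_mem hF hmin hG
    have hker : Ideal.span {F} ⊔ (q.comap Polynomial.C).map Polynomial.C ≤
        RingHom.ker (Polynomial.eval₂RingHom (eval v) η) :=
      sup_le (Ideal.span_singleton_le_iff_mem _ |>.2 hη)
        fun _ hG => eval₂_eval_eq_zero_of_mem_map_C hv hG η
    have hzero : eval v F.leadingCoeff ^ N * G.eval₂ (eval v) η = 0 := by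
      simpa only [RingHom.mem_ker, map_mul, map_pow, Polynomial.coe_eval₂RingHom,
        Polynomial.eval₂_C] using hker hN
    exact (mul_eq_zero.1 hzero).resolve_left (pow_ne_zero _ hvlc)

end PrimeProjection

/-- A subset of affine space is locally algebraic if it is the intersection of an open set with an
algebraic set; finite unions of such sets stand in for semialgebraic sets. -/
def IsLocallyAlgebraic {ι : Type*} (A : Set (ι → ℝ)) : Prop :=
  ∃ (s : Set (MvPolynomial ι ℝ)) (O : Set (ι → ℝ)), IsOpen O ∧
    A = O ∩ {x | ∀ p ∈ s, MvPolynomial.eval x p = 0}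

section VanishingIdeal

open MvPolynomial

variable {ι κ : Type*} {A : Set (ι → ℝ)}

theorem zariskiDense_iff_vanishingIdeal_eq_bot : ZariskiDense A ↔ vanishingIdeal ℝ A = ⊥ :=
  (eq_bot_iff (a := vanishingIdeal ℝ A)).symm

theorem vanishingIdeal_image_comp (f : κ → ι) (A : Set (ι → ℝ)) :
    vanishingIdeal ℝ ((fun a => a ∘ f) '' A) = (vanishingIdeal ℝ A).comap (rename f) := by
  ext p
  simp only [mem_vanishingIdeal_iff, forall_mem_image, Ideal.mem_comap, aeval_rename]

theorem isPrime_vanishingIdeal_image_comp (hA : (vanishingIdeal ℝ A).IsPrime) (f : κ → ι) :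
    (vanishingIdeal ℝ ((fun a => a ∘ f) '' A)).IsPrime := by
  rw [vanishingIdeal_image_comp]
  exact Ideal.IsPrime.comap _

end VanishingIdeal

namespace IsLocallyAlgebraic

open MvPolynomial
open scoped Polynomial

variable {ι κ σ : Type*} {A B : Set (ι → ℝ)}

theorem inter (hA : IsLocallyAlgebraic A) (hB : IsLocallyAlgebraic B) :
    IsLocallyAlgebraic (A ∩ B) := by
  obtain ⟨s, O, hO, rfl⟩ := hA
  obtain ⟨t, Q, hQ, rfl⟩ := hB
  refine ⟨s ∪ t, O ∩ Q, hO.inter hQ, ?_⟩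
  rw [inter_inter_inter_comm]
  congr 1
  ext x
  simp only [mem_inter_iff, mem_ofPred_eq, mem_union, or_imp, forall_and]

theorem of_isOpen (hA : IsOpen A) : IsLocallyAlgebraic A :=
  ⟨∅, A, hA, by simp⟩

theorem zeros (p : MvPolynomial ι ℝ) : IsLocallyAlgebraic {x | eval x p = 0} :=
  ⟨{p}, univ, isOpen_univ, by simp⟩

theorem preimage_comp (hA : IsLocallyAlgebraic A) (g : ι → κ) :
    IsLocallyAlgebraic {x : κ → ℝ | x ∘ g ∈ A} := by
  obtain ⟨s, O, hO, rfl⟩ := hA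
  refine ⟨rename g '' s, {x | x ∘ g ∈ O}, hO.preimage (by fun_prop), ?_⟩
  ext x
  simp [eval_rename]

theorem image_comp_equiv (hA : IsLocallyAlgebraic A) (e : κ ≃ ι) :
    IsLocallyAlgebraic ((fun a => a ∘ e) '' A) := by
  convert hA.preimage_comp e.symm using 1
  exact (e.symm.arrowCongr (.refl ℝ)).image_eq_preimage_symm A

theorem exists_isOpen_eq (hA : IsLocallyAlgebraic A) :
    ∃ O : Set (ι → ℝ), IsOpen O ∧ A = O ∩ {x | ∀ p ∈ vanishingIdeal ℝ A, eval x p = 0} := by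
  obtain ⟨s, O, hO, h⟩ := hA
  refine ⟨O, hO, subset_antisymm (fun x hx => ⟨(h ▸ hx : x ∈ O ∩ _).1, fun p hp => hp x hx⟩) ?_⟩
  intro x hx
  rw [h] at hx ⊢
  exact ⟨hx.1, fun p hp => hx.2 p fun y hy => hy.2 p hp⟩

theorem exists_minimal [Finite ι] (hA : IsLocallyAlgebraic A) {f : κ → ι}
    (hf : ZariskiDense ((fun a => a ∘ f) '' A)) :
    ∃ A' ⊆ A, IsLocallyAlgebraic A' ∧ ZariskiDense ((fun a => a ∘ f) '' A') ∧
      ∀ B ⊆ A', IsLocallyAlgebraic B → ZariskiDense ((fun a => a ∘ f) '' B) →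
        vanishingIdeal ℝ B ≤ vanishingIdeal ℝ A' := by
  obtain ⟨_, ⟨A', hA'A, hA', hfA', rfl⟩, hmax⟩ :=
    (wellFounded_gt (α := Ideal (MvPolynomial ι ℝ))).has_min
      {J | ∃ A' ⊆ A, IsLocallyAlgebraic A' ∧ ZariskiDense ((fun a => a ∘ f) '' A') ∧
        vanishingIdeal ℝ A' = J}
      ⟨_, A, subset_rfl, hA, hf, rfl⟩
  refine ⟨A', hA'A, hA', hfA', fun B hBA hB hfB => ?_⟩
  exact (eq_of_le_of_not_lt (vanishingIdeal_anti_mono hBA)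
    (hmax _ ⟨B, hBA.trans hA'A, hB, hfB, rfl⟩)).ge

theorem exists_isPrime_vanishingIdeal [Finite ι] (hA : IsLocallyAlgebraic A) {f : κ → ι}
    (hf : ZariskiDense ((fun a => a ∘ f) '' A)) :
    ∃ A' ⊆ A, IsLocallyAlgebraic A' ∧ (vanishingIdeal ℝ A').IsPrime ∧
      ZariskiDense ((fun a => a ∘ f) '' A') := by
  obtain ⟨A', hA'A, hA', hfA', hmin⟩ := hA.exists_minimal hf
  refine ⟨A', hA'A, hA', ⟨?_, fun {g h} hgh => ?_⟩, hfA'⟩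
  · rw [Ideal.ne_top_iff_one]
    intro h1
    obtain ⟨_, a, ha, -⟩ := hfA'.nonempty
    exact one_ne_zero ((map_one _).symm.trans (h1 a ha))
  · let T (b : Bool) : Set (ι → ℝ) := A' ∩ if b then {x | eval x g = 0} else {x | eval x g ≠ 0}
    have hT : (fun a => a ∘ f) '' A' ⊆ ⋃ b, (fun a => a ∘ f) '' T b := by
      rw [← image_iUnion]
      refine image_mono fun a ha => mem_iUnion.2 ?_
      by_cases hg : eval a g = 0
      exacts [⟨true, ha, hg⟩, ⟨false, ha, hg⟩]
    obtain ⟨_ | _, hb⟩ := hfA'.exists_of_subset_iUnion hT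
    · have hopen : IsOpen {x : ι → ℝ | eval x g ≠ 0} :=
        isOpen_ne_fun (continuous_eval g) continuous_const
      refine .inr (hmin (T false) inter_subset_left (hA'.inter (of_isOpen hopen)) hb fun x hx => ?_)
      exact (mul_eq_zero.1 ((map_mul (aeval x) g h).symm.trans (hgh x hx.1))).resolve_left hx.2
    · exact .inl (hmin (T true) inter_subset_left (hA'.inter (zeros g)) hb fun x hx => hx.2)

theorem eval_optionEquivLeft_symm (a : Option σ → ℝ) (F : (MvPolynomial σ ℝ)[X]) :
    eval a ((optionEquivLeft ℝ σ).symm F) = F.eval₂ (eval (a ∘ some)) (a none) := by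
  obtain ⟨p, rfl⟩ := (optionEquivLeft ℝ σ).surjective F
  have ha : (fun o : Option σ => o.elim (a none) (a ∘ some)) = a := by
    funext o
    cases o <;> rfl
  rw [AlgEquiv.symm_apply_apply, Polynomial.eval₂_eq_eval_map, ← optionEquivLeft_elim_eval, ha]

theorem exists_notMem_forall_comp_some_mem_interior {A : Set (Option σ → ℝ)}
    (hA : IsLocallyAlgebraic A) (hp : (vanishingIdeal ℝ A).IsPrime) :
    ∃ h ∉ vanishingIdeal ℝ A, ∀ a ∈ A, eval a h ≠ 0 → a ∘ some ∈ interior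
      {u | (∀ g ∈ vanishingIdeal ℝ ((fun a => a ∘ some) '' A), eval u g = 0) →
        u ∈ (fun a => a ∘ some) '' A} := by
  obtain ⟨O, hO, hAO⟩ := hA.exists_isOpen_eq
  let e := optionEquivLeft ℝ σ
  let q : Ideal (MvPolynomial σ ℝ)[X] := (vanishingIdeal ℝ A).comap e.symm
  have hC (g : MvPolynomial σ ℝ) (hg : g ∈ q.comap Polynomial.C) :
      g ∈ vanishingIdeal ℝ ((fun a => a ∘ some) '' A) := by
    rintro _ ⟨a, ha, rfl⟩
    have := hg a ha
    rwa [aeval_eq_eval, eval_optionEquivLeft_symm, Polynomial.eval₂_C] at this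
  obtain ⟨h, hhq, hh⟩ :=
    exists_notMem_forall_eventually_exists_zero (q := q) (Ideal.IsPrime.comap _)
  refine ⟨e.symm h, hhq, fun a ha hne => ?_⟩
  rw [eval_optionEquivLeft_symm] at hne
  let pt (z : (σ → ℝ) × ℝ) : Option σ → ℝ := fun o => o.elim z.2 z.1
  have hpt : Continuous pt := continuous_pi fun o => by cases o <;> dsimp [pt] <;> fun_prop
  have haO : pt (a ∘ some, a none) ∈ O := by
    rw [show pt (a ∘ some, a none) = a by ext (_ | _) <;> rfl]
    exact (hAO ▸ ha : a ∈ O ∩ _).1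
  have haq (F : (MvPolynomial σ ℝ)[X]) (hF : F ∈ q) : F.eval₂ (eval (a ∘ some)) (a none) = 0 := by
    rw [← eval_optionEquivLeft_symm]
    exact hF a ha
  rw [mem_interior_iff_mem_nhds]
  filter_upwards [hh _ _ haq hne _ ((hO.preimage hpt).mem_nhds haO)] with v hv hvA
  obtain ⟨η, hηO, hη⟩ := hv fun g hg => hvA g (hC g hg)
  refine ⟨pt (v, η), hAO ▸ ⟨hηO, fun p hpA => ?_⟩, rfl⟩
  rw [← e.symm_apply_apply p, eval_optionEquivLeft_symm]
  exact hη _ (by simpa [q] using hpA)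

theorem exists_subset_image_comp_some {A : Set (Option σ → ℝ)} (hA : IsLocallyAlgebraic A)
    (hp : (vanishingIdeal ℝ A).IsPrime) :
    ∃ A' ⊆ (fun a => a ∘ some) '' A, IsLocallyAlgebraic A' ∧
      vanishingIdeal ℝ A' = vanishingIdeal ℝ ((fun a => a ∘ some) '' A) := by
  obtain ⟨h, hhA, hh⟩ := hA.exists_notMem_forall_comp_some_mem_interior hp
  let V : Set (σ → ℝ) :=
    {u | ∀ g ∈ vanishingIdeal ℝ ((fun a => a ∘ some) '' A), eval u g = 0}
  let Q : Set (σ → ℝ) := interior {u | u ∈ V → u ∈ (fun a => a ∘ some) '' A}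
  have hsub : Q ∩ V ⊆ (fun a => a ∘ some) '' A := fun u hu => interior_subset hu.1 hu.2
  refine ⟨Q ∩ V, hsub, ⟨_, Q, isOpen_interior, rfl⟩,
    le_antisymm (fun g hg => ?_) (vanishingIdeal_anti_mono hsub)⟩
  rw [vanishingIdeal_image_comp]
  refine (hp.mem_or_mem (y := h) fun a ha => ?_).resolve_right hhA
  rw [map_mul, aeval_rename, mul_eq_zero, or_iff_not_imp_right]
  exact fun hne => hg _ ⟨hh a ha hne, fun g' hg' => hg' _ ⟨a, ha, rfl⟩⟩

theorem exists_subset_image_comp_inl {κ γ : Type*} [Finite γ] {A : Set (κ ⊕ γ → ℝ)}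
    (hA : IsLocallyAlgebraic A) (hp : (vanishingIdeal ℝ A).IsPrime) :
    ∃ A' ⊆ (fun a => a ∘ Sum.inl) '' A, IsLocallyAlgebraic A' ∧
      vanishingIdeal ℝ A' = vanishingIdeal ℝ ((fun a => a ∘ Sum.inl) '' A) := by
  induction γ using Finite.induction_empty_option with
  | of_equiv e ih =>
    let e' := Equiv.sumCongr (Equiv.refl κ) e
    have := ih (hA.image_comp_equiv e') (isPrime_vanishingIdeal_image_comp hp e')
    rwa [image_image] at this
  | h_empty => exact ⟨_, subset_rfl, hA.image_comp_equiv (Equiv.sumEmpty κ PEmpty).symm, rfl⟩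
  | @h_option γ _ ih =>
    let e : Option (κ ⊕ γ) ≃ κ ⊕ Option γ :=
      (Equiv.optionEquivSumPUnit.{0} _).trans ((Equiv.sumAssoc _ _ _).trans
        ((Equiv.refl κ).sumCongr (Equiv.optionEquivSumPUnit.{0} γ).symm))
    have hpe := isPrime_vanishingIdeal_image_comp hp e
    obtain ⟨A₁, hA₁A, hA₁, hvA₁⟩ := (hA.image_comp_equiv e).exists_subset_image_comp_some hpe
    obtain ⟨A₂, hA₂A₁, hA₂, hvA₂⟩ :=
      ih hA₁ (hvA₁ ▸ isPrime_vanishingIdeal_image_comp hpe some)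
    have himage : (fun a => a ∘ Sum.inl) '' A = (fun a : κ ⊕ γ → ℝ => a ∘ Sum.inl) ''
        ((fun a => a ∘ some) '' ((fun a => a ∘ e) '' A)) := by
      rw [image_image, image_image]
      rfl
    refine ⟨A₂, himage ▸ hA₂A₁.trans (image_mono hA₁A), hA₂, ?_⟩
    rw [hvA₂, himage, vanishingIdeal_image_comp, hvA₁, ← vanishingIdeal_image_comp]

theorem interior_image_comp_nonempty [Finite ι] (hA : IsLocallyAlgebraic A)
    (hp : (vanishingIdeal ℝ A).IsPrime) {f : κ → ι} (hf : ZariskiDense ((fun a => a ∘ f) '' A)) :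
    (interior ((fun a => a ∘ f) '' A)).Nonempty := by
  classical
  have hinj : Function.Injective f := fun i j hij =>
    ZariskiDense.injective (x := fun k (a : ι → ℝ) => a (f k)) hf (by simp only [hij])
  let e : κ ⊕ ↥(range f)ᶜ ≃ ι :=
    ((Equiv.ofInjective f hinj).sumCongr (.refl _)).trans (Equiv.Set.sumCompl (range f))
  have himage : (fun a => a ∘ Sum.inl) '' ((fun a => a ∘ e) '' A) = (fun a => a ∘ f) '' A := by
    rw [image_image]
    rfl
  obtain ⟨A', hA'A, hA', hv⟩ :=
    (hA.image_comp_equiv e).exists_subset_image_comp_inl (isPrime_vanishingIdeal_image_comp hp e)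
  rw [himage] at hA'A hv
  rw [zariskiDense_iff_vanishingIdeal_eq_bot.1 hf] at hv
  obtain ⟨O, hO, hA'O⟩ := hA'.exists_isOpen_eq
  have hopen : IsOpen A' := by
    rw [hA'O, hv]
    simpa using hO
  exact (zariskiDense_iff_vanishingIdeal_eq_bot.2 hv).nonempty.mono (interior_maximal hA'A hopen)

end IsLocallyAlgebraic

/-- A set is piecewise algebraic if it is a finite union of locally algebraic sets. Semialgebraic
sets are of this form; unlike them, these sets need not have piecewise algebraic projections. -/
def IsPiecewiseAlgebraic {ι : Type*} (A : Set (ι → ℝ)) : Prop :=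
  ∃ T : Set (Set (ι → ℝ)), T.Finite ∧ (∀ B ∈ T, IsLocallyAlgebraic B) ∧ A = ⋃₀ T

theorem IsLocallyAlgebraic.isPiecewiseAlgebraic {ι : Type*} {A : Set (ι → ℝ)}
    (hA : IsLocallyAlgebraic A) : IsPiecewiseAlgebraic A :=
  ⟨{A}, finite_singleton A, by simpa using hA, by simp⟩

namespace IsPiecewiseAlgebraic

variable {ι κ : Type*} {A B : Set (ι → ℝ)}

theorem union (hA : IsPiecewiseAlgebraic A) (hB : IsPiecewiseAlgebraic B) :
    IsPiecewiseAlgebraic (A ∪ B) := by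
  obtain ⟨S, hS, hS', rfl⟩ := hA
  obtain ⟨T, hT, hT', rfl⟩ := hB
  exact ⟨S ∪ T, hS.union hT, fun B hB => hB.elim (hS' B) (hT' B), (sUnion_union S T).symm⟩

theorem inter (hA : IsPiecewiseAlgebraic A) (hB : IsPiecewiseAlgebraic B) :
    IsPiecewiseAlgebraic (A ∩ B) := by
  obtain ⟨S, hS, hS', rfl⟩ := hA
  obtain ⟨T, hT, hT', rfl⟩ := hB
  refine ⟨image2 (· ∩ ·) S T, hS.image2 _ hT, ?_, ?_⟩
  · rintro _ ⟨B, hB, C, hC, rfl⟩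
    exact (hS' B hB).inter (hT' C hC)
  · rw [sUnion_inter_sUnion, ← image_uncurry_prod, sUnion_image]
    rfl

theorem exists_isPrime_vanishingIdeal [Finite ι] (hA : IsPiecewiseAlgebraic A) {f : κ → ι}
    (hf : ZariskiDense ((fun a => a ∘ f) '' A)) :
    ∃ A' ⊆ A, IsLocallyAlgebraic A' ∧ (MvPolynomial.vanishingIdeal ℝ A').IsPrime ∧
      ZariskiDense ((fun a => a ∘ f) '' A') := by
  obtain ⟨T, hT, hT', rfl⟩ := hA
  have := hT.to_subtype
  obtain ⟨B, hB⟩ := hf.exists_of_subset_iUnion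
    (T := fun B : T => (fun a => a ∘ f) '' (B : Set (ι → ℝ)))
    (by rw [sUnion_eq_iUnion, image_iUnion])
  obtain ⟨A', hA'B, hA'⟩ := (hT' B B.2).exists_isPrime_vanishingIdeal hB
  exact ⟨A', hA'B.trans (subset_sUnion_of_mem B.2), hA'⟩

end IsPiecewiseAlgebraic

section CoordMatroid

open MvPolynomial

variable {ι κ : Type*}

theorem image_comp_zariskiDense_iff_algebraicIndependent_mk {A : Set (ι → ℝ)} {f : κ → ι} :
    ZariskiDense ((fun a => a ∘ f) '' A) ↔
      AlgebraicIndependent ℝ (Ideal.Quotient.mk (vanishingIdeal ℝ A) ∘ X ∘ f) := by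
  rw [algebraicIndependent_iff]
  refine forall_congr' fun p => imp_congr_left ?_
  have hp : aeval (Ideal.Quotient.mk (vanishingIdeal ℝ A) ∘ X ∘ f) p =
      Ideal.Quotient.mk (vanishingIdeal ℝ A) (rename f p) := by
    rw [rename_eq_aeval]
    exact (comp_aeval_apply (φ := Ideal.Quotient.mkₐ ℝ (vanishingIdeal ℝ A)) (X ∘ f) p).symm
  rw [hp, Ideal.Quotient.eq_zero_iff_mem, ← Ideal.mem_comap, ← vanishingIdeal_image_comp]
  rfl

/-- The algebraic matroid of a family `x` of elements of a domain. -/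
noncomputable def algebraicMatroid (k : Type*) {R : Type*} [Field k] [CommRing R] [IsDomain R]
    [Algebra k R] (x : ι → R) : Matroid ι :=
  (AlgebraicIndependent.matroid k R).comap x

theorem algebraicIndependent_comp_iff_algebraicMatroid_indep {k R : Type*} [Field k] [CommRing R]
    [IsDomain R] [Algebra k R] {x : ι → R} {f : κ → ι} :
    AlgebraicIndependent k (x ∘ f) ↔
      Function.Injective f ∧ (algebraicMatroid k x).Indep (range f) := by
  rw [algebraicMatroid, Matroid.comap_indep_iff, ← range_comp]
  constructor
  · intro h
    refine ⟨h.injective.of_comp, h.to_subtype_range, ?_⟩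
    rintro _ ⟨i, rfl⟩ _ ⟨j, rfl⟩ hij
    exact congrArg f (h.injective hij)
  · rintro ⟨hf, h, hx⟩
    exact .of_subtype_range (fun i j hij => hf (hx ⟨i, rfl⟩ ⟨j, rfl⟩ hij)) h

/-- The algebraic matroid of the coordinates on an irreducible set `A`: coordinates are independent
if no nonzero polynomial in them vanishes on `A`. -/
noncomputable def coordMatroid (A : Set (ι → ℝ)) [(vanishingIdeal ℝ A).IsPrime] : Matroid ι :=
  algebraicMatroid ℝ (Ideal.Quotient.mk (vanishingIdeal ℝ A) ∘ X)

variable {A : Set (ι → ℝ)} [(vanishingIdeal ℝ A).IsPrime]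

theorem image_comp_zariskiDense_iff_coordMatroid_indep {f : κ → ι} :
    ZariskiDense ((fun a => a ∘ f) '' A) ↔
      Function.Injective f ∧ (coordMatroid A).Indep (range f) :=
  image_comp_zariskiDense_iff_algebraicIndependent_mk.trans
    (algebraicIndependent_comp_iff_algebraicMatroid_indep
      (x := Ideal.Quotient.mk (vanishingIdeal ℝ A) ∘ X))

@[simp]
theorem coordMatroid_ground : (coordMatroid A).E = univ := rfl

theorem exists_isBase_inter_isBasis_coordMatroid [Finite ι] (s : Set ι) {d : ℕ} {f : Fin d → ι}
    (hf : ZariskiDense ((fun a => a ∘ f) '' A)) :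
    ∃ D, (coordMatroid A).IsBase D ∧ (coordMatroid A).IsBasis (D ∩ s) s ∧ d ≤ D.ncard := by
  obtain ⟨hinj, hindep⟩ := image_comp_zariskiDense_iff_coordMatroid_indep.1 hf
  obtain ⟨I, hI⟩ := (coordMatroid A).exists_isBasis s (by simp)
  obtain ⟨D, hD, rfl⟩ := hI.exists_isBase
  obtain ⟨D', hD', hfD'⟩ := hindep.exists_isBase_superset
  refine ⟨D, hD, hI, ?_⟩
  calc d = (range f).ncard := by rw [← Nat.card_coe_set_eq, Nat.card_range_of_injective hinj,
        Nat.card_fin]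
    _ ≤ D'.ncard := ncard_le_ncard hfD'
    _ = D.ncard := hD'.ncard_eq_ncard_of_isBase hD

theorem not_zariskiDense_of_isBasis {s I : Set ι} (hI : (coordMatroid A).IsBasis I s) {i : ι}
    (hi : i ∈ s) :
    ¬ ZariskiDense ((fun a (o : Option I) => o.elim (a i) fun j => a j) '' A) := by
  have hcomp : (fun (a : ι → ℝ) (o : Option I) => o.elim (a i) fun j => a j) =
      fun a : ι → ℝ => a ∘ fun o : Option I => o.elim i (↑) := by
    funext a o
    cases o <;> rfl
  rw [hcomp, image_comp_zariskiDense_iff_coordMatroid_indep]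
  rintro ⟨hinj, hindep⟩
  have hiI : i ∉ I := fun hiI => by simpa using @hinj none (some ⟨i, hiI⟩) rfl
  rw [Option.range_elim, Subtype.range_coe] at hindep
  exact hiI (hI.mem_of_insert_indep hi hindep)

end CoordMatroid

section Slices

open MvPolynomial

theorem exists_ne_zero_forall_finite_setOf_elim_mem {σ : Type*} {A : Set (Option σ → ℝ)}
    (hA : ¬ ZariskiDense A) :
    ∃ g : MvPolynomial σ ℝ, g ≠ 0 ∧
      ∀ u, eval u g ≠ 0 → {r : ℝ | (fun o => o.elim r u) ∈ A}.Finite := by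
  simp only [ZariskiDense, not_forall] at hA
  obtain ⟨p, hp, hp0⟩ := hA
  let P := optionEquivLeft ℝ σ p
  have hP : P ≠ 0 := by simpa [P] using hp0
  refine ⟨P.leadingCoeff, Polynomial.leadingCoeff_ne_zero.2 hP, fun u hu => ?_⟩
  have hPu : P.map (eval u) ≠ 0 := fun h0 => hu <| by
    simpa using congrArg (fun q => q.coeff P.natDegree) h0
  refine (Polynomial.finite_setOfPred_isRoot hPu).subset fun r hr => ?_
  have := hp _ hr
  rwa [optionEquivLeft_elim_eval] at this

theorem exists_ne_zero_forall_finite_image_of_not_zariskiDense {α σ X : Type*} [Finite α]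
    {B : Set X} {x : X → σ → ℝ} {y : X → α → ℝ}
    (h : ∀ i, ¬ ZariskiDense ((fun a (o : Option σ) => o.elim (y a i) (x a)) '' B)) :
    ∃ g : MvPolynomial σ ℝ, g ≠ 0 ∧ ∀ u, eval u g ≠ 0 → (y '' {a ∈ B | x a = u}).Finite := by
  cases nonempty_fintype α
  choose g hg0 hg using fun i => exists_ne_zero_forall_finite_setOf_elim_mem (h i)
  refine ⟨∏ i, g i, Finset.prod_ne_zero_iff.2 fun i _ => hg0 i, fun u hu => ?_⟩
  rw [map_prod, Finset.prod_ne_zero_iff] at hu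
  refine (Set.Finite.pi fun i => hg i u (hu i (Finset.mem_univ i))).subset ?_
  rintro _ ⟨a, ⟨ha, rfl⟩, rfl⟩ i -
  exact ⟨a, ha, rfl⟩

theorem exists_eval_ne_zero_zariskiDense_slice {I J : Type*} [Finite I] [Finite J]
    {S : Set (I ⊕ J → ℝ)} (hS : (interior S).Nonempty) {g : MvPolynomial I ℝ} (hg : g ≠ 0) :
    ∃ u, eval u g ≠ 0 ∧ ZariskiDense {z : J → ℝ | Sum.elim u z ∈ S} := by
  obtain ⟨w, hw⟩ := hS
  have hcont : Continuous fun v : (I → ℝ) × (J → ℝ) => Sum.elim v.1 v.2 :=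
    continuous_pi fun i => by cases i <;> dsimp <;> fun_prop
  have hopen : IsOpen {v : (I → ℝ) × (J → ℝ) | Sum.elim v.1 v.2 ∈ interior S} :=
    isOpen_interior.preimage hcont
  have hI : IsOpen {u : I → ℝ | Sum.elim u (w ∘ Sum.inr) ∈ interior S} :=
    hopen.preimage (by fun_prop : Continuous fun u : I → ℝ => (u, w ∘ Sum.inr))
  obtain ⟨u, huS, hu⟩ : ∃ u, Sum.elim u (w ∘ Sum.inr) ∈ interior S ∧ eval u g ≠ 0 := by
    by_contra! h
    have hw' : w ∘ Sum.inl ∈ {u | Sum.elim u (w ∘ Sum.inr) ∈ interior S} := by simpa using hw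
    exact hg (ZariskiDense.of_interior_nonempty ⟨_, hI.interior_eq.symm ▸ hw'⟩ g h)
  have hJ : IsOpen {z : J → ℝ | Sum.elim u z ∈ interior S} :=
    hopen.preimage (by fun_prop : Continuous fun z : J → ℝ => (u, z))
  have hsub : {z : J → ℝ | Sum.elim u z ∈ interior S} ⊆ {z | Sum.elim u z ∈ S} :=
    fun z hz => interior_subset (s := S) hz
  exact ⟨u, hu, .of_interior_nonempty ⟨w ∘ Sum.inr, interior_maximal hsub hJ huS⟩⟩

end Slices

theorem IsPiecewiseAlgebraic.semialgDim_le_add_of_fibers {ι : Type*} [Finite ι] {M : Set (ι → ℝ)}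
    (hM : IsPiecewiseAlgebraic M) (s : Set ι) {b e : ℕ}
    (hb : semialgDim (s.domRestrict '' M) ≤ b)
    (he : ∀ y, semialgDim {a ∈ M | s.domRestrict a = y} ≤ e) :
    semialgDim M ≤ ((b + e : ℕ) : WithBot ℕ∞) := by
  refine le_of_forall_natCast_le fun d hd => Nat.cast_le.2 ?_
  obtain ⟨f, hf⟩ := natCast_le_semialgDim_pi_iff.1 hd
  obtain ⟨B, hBM, hB, hBprime, hBf⟩ := hM.exists_isPrime_vanishingIdeal hf
  obtain ⟨D, hD, hDs, hdD⟩ := exists_isBase_inter_isBasis_coordMatroid s hBf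
  let c : ↥(D ∩ s) ⊕ ↥(D \ s) → ι := Sum.elim (↑) (↑)
  have hc : ZariskiDense ((fun a => a ∘ c) '' B) := by
    refine image_comp_zariskiDense_iff_coordMatroid_indep.2 ⟨?_, ?_⟩
    · exact Subtype.val_injective.sumElim Subtype.val_injective
        fun i j hij => j.2.2 (hij ▸ i.2.2)
    · rw [Sum.elim_range, Subtype.range_coe, Subtype.range_coe, inter_union_sdiff]
      exact hD.indep
  have hbase : (D ∩ s).ncard ≤ b := by
    refine Nat.cast_le.1 ((natCard_le_semialgDim (κ := ↥(D ∩ s))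
      (LinearMap.funLeft ℝ ℝ (inclusion inter_subset_right)) ?_).trans hb)
    refine (hc.image_comp Sum.inl_injective).mono ?_
    rintro _ ⟨_, ⟨a, ha, rfl⟩, rfl⟩
    exact ⟨_, ⟨a, hBM ha, rfl⟩, rfl⟩
  obtain ⟨g, hg0, hg⟩ := exists_ne_zero_forall_finite_image_of_not_zariskiDense
    (B := B) (x := fun (a : ι → ℝ) (j : ↥(D ∩ s)) => a j) (y := s.domRestrict)
    fun i : s => not_zariskiDense_of_isBasis hDs i.2
  obtain ⟨u, hu, hslice⟩ := exists_eval_ne_zero_zariskiDense_slice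
    (hB.interior_image_comp_nonempty hBprime hc) hg0
  have := (hg u hu).to_subtype
  obtain ⟨y, hy⟩ := hslice.exists_of_subset_iUnion
    (T := fun y : ↥(s.domRestrict '' {a ∈ B | (fun j : ↥(D ∩ s) => a j) = u}) =>
      LinearMap.funLeft ℝ ℝ (Subtype.val : ↥(D \ s) → ι) '' {a ∈ M | s.domRestrict a = y}) <| by
    rintro z ⟨a, ha, haz⟩
    have hau : (fun j : ↥(D ∩ s) => a j) = u := funext fun j => congrFun haz (.inl j)
    exact mem_iUnion.2 ⟨⟨_, a, ⟨ha, hau⟩, rfl⟩, a, ⟨hBM ha, rfl⟩,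
      funext fun j => congrFun haz (.inr j)⟩
  have hfiber : (D \ s).ncard ≤ e := Nat.cast_le.1 ((natCard_le_semialgDim _ hy).trans (he y.1))
  have := ncard_inter_add_ncard_sdiff_eq_ncard D s
  omega

section Semialgebraic

variable {E F ι : Type*} [AddCommGroup E] [Module ℝ E] [AddCommGroup F] [Module ℝ F]

theorem comp_affineMap_mem_adjoin {f : E → ℝ}
    (hf : f ∈ Algebra.adjoin ℝ (range fun (l : E →ₗ[ℝ] ℝ) (x : E) => l x)) (ψ : F →ᵃ[ℝ] E) :
    f ∘ ψ ∈ Algebra.adjoin ℝ (range fun (l : F →ₗ[ℝ] ℝ) (x : F) => l x) := by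
  induction hf using Algebra.adjoin_induction with
  | mem f hf =>
    obtain ⟨l, rfl⟩ := hf
    have hl : (fun x => l x) ∘ ψ =
        (fun x => (l ∘ₗ ψ.linear) x) + algebraMap ℝ (F → ℝ) (l (ψ 0)) := by
      funext x
      simp [ψ.decomp']
    rw [hl]
    exact add_mem (Algebra.subset_adjoin ⟨l ∘ₗ ψ.linear, rfl⟩) (Subalgebra.algebraMap_mem _ _)
  | algebraMap r => exact Subalgebra.algebraMap_mem _ r
  | add f g _ _ hf hg => exact add_mem hf hg
  | mul f g _ _ hf hg => exact mul_mem hf hg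

theorem exists_mvPolynomial_eval_eq [Finite ι] {f : (ι → ℝ) → ℝ}
    (hf : f ∈ Algebra.adjoin ℝ (range fun (l : (ι → ℝ) →ₗ[ℝ] ℝ) (x : ι → ℝ) => l x)) :
    ∃ p : MvPolynomial ι ℝ, ∀ x, f x = MvPolynomial.eval x p := by
  cases nonempty_fintype ι
  classical
  induction hf using Algebra.adjoin_induction with
  | mem f hf =>
    obtain ⟨l, rfl⟩ := hf
    refine ⟨∑ i, MvPolynomial.C (l (Pi.single i 1)) * MvPolynomial.X i, fun x => ?_⟩
    conv_lhs => rw [pi_eq_sum_univ' x]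
    simp [mul_comm]
  | algebraMap r => exact ⟨MvPolynomial.C r, fun x => by simp⟩
  | add f g _ _ hf hg =>
    obtain ⟨p, hp⟩ := hf
    obtain ⟨q, hq⟩ := hg
    exact ⟨p + q, fun x => by simp [hp, hq]⟩
  | mul f g _ _ hf hg =>
    obtain ⟨p, hp⟩ := hf
    obtain ⟨q, hq⟩ := hg
    exact ⟨p * q, fun x => by simp [hp, hq]⟩

namespace IsSemialgebraic

theorem inter {A B : Set E} (hA : IsSemialgebraic A) (hB : IsSemialgebraic B) :
    IsSemialgebraic (A ∩ B) := by
  rw [← compl_compl (A ∩ B), compl_inter]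
  exact .compl _ (.union _ _ (.compl _ hA) (.compl _ hB))

theorem preimage_affineMap {A : Set E} (hA : IsSemialgebraic A) (ψ : F →ᵃ[ℝ] E) :
    IsSemialgebraic (ψ ⁻¹' A) := by
  induction hA with
  | pos f hf => exact .pos _ (comp_affineMap_mem_adjoin hf ψ)
  | compl A _ ih => exact .compl _ ih
  | union A B _ _ ihA ihB => exact .union _ _ ihA ihB

theorem preimage_linearMap {A : Set E} (hA : IsSemialgebraic A) (ψ : F →ₗ[ℝ] E) :
    IsSemialgebraic (ψ ⁻¹' A) :=
  hA.preimage_affineMap ψ.toAffineMap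

theorem image_linearEquiv {A : Set E} (hA : IsSemialgebraic A) (e : E ≃ₗ[ℝ] F) :
    IsSemialgebraic (e '' A) := by
  rw [LinearEquiv.image_eq_preimage_symm]
  exact hA.preimage_linearMap e.symm.toLinearMap

theorem preimage_prodMk {M : Set (E × F)} (hM : IsSemialgebraic M) (x : E) :
    IsSemialgebraic {y | (x, y) ∈ M} :=
  hM.preimage_affineMap ((AffineMap.const ℝ F x).prod (AffineMap.id ℝ F))

theorem isPiecewiseAlgebraic [Finite ι] {A : Set (ι → ℝ)} (hA : IsSemialgebraic A) :
    IsPiecewiseAlgebraic A := by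
  suffices IsPiecewiseAlgebraic A ∧ IsPiecewiseAlgebraic Aᶜ from this.1
  induction hA with
  | pos f hf =>
    obtain ⟨p, hp⟩ := exists_mvPolynomial_eval_eq hf
    have hcont := MvPolynomial.continuous_eval p
    have hcompl : {x | 0 < f x}ᶜ =
        {x | MvPolynomial.eval x p = 0} ∪ {x | MvPolynomial.eval x p < 0} := by
      ext x
      simp [hp, le_iff_eq_or_lt]
    rw [hcompl]
    simp only [hp]
    exact ⟨(IsLocallyAlgebraic.of_isOpen (isOpen_lt continuous_const hcont)).isPiecewiseAlgebraic,
      (IsLocallyAlgebraic.zeros p).isPiecewiseAlgebraic.union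
        (IsLocallyAlgebraic.of_isOpen (isOpen_lt hcont continuous_const)).isPiecewiseAlgebraic⟩
  | compl A _ ih => exact ⟨ih.2, by simpa using ih.1⟩
  | union A B _ _ ihA ihB =>
    rw [compl_union]
    exact ⟨ihA.1.union ihB.1, ihA.2.inter ihB.2⟩

theorem semialgDim_le_add_of_fibers [FiniteDimensional ℝ E] [FiniteDimensional ℝ F]
    {M : Set (E × F)} (hM : IsSemialgebraic M) {e : ℕ}
    (he : ∀ x, semialgDim {y | (x, y) ∈ M} ≤ e) :
    semialgDim M ≤ semialgDim (Prod.fst '' M) + e := by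
  rcases M.eq_empty_or_nonempty with rfl | hne
  · simp [semialgDim_empty]
  obtain ⟨b, hb⟩ := exists_semialgDim_eq_natCast (hne.image Prod.fst)
  let B := finBasis ℝ E
  let Φ := (B.prod (finBasis ℝ F)).equivFun
  let s : Set (Fin (finrank ℝ E) ⊕ Fin (finrank ℝ F)) := {i | i.isLeft}
  let ψ : E →ₗ[ℝ] s → ℝ := .pi fun i => B.coord (i.1.getLeft i.2)
  have hψ (p : E × F) : s.domRestrict (Φ p) = ψ p.1 := by
    ext ⟨i, hi⟩
    obtain ⟨j, rfl⟩ := Sum.isLeft_iff.1 hi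
    simp [Φ, ψ]
  have hψinj : Function.Injective ψ := fun x x' h => B.ext_elem fun j =>
    congrFun h ⟨.inl j, rfl⟩
  rw [hb, ← semialgDim_image_equiv Φ M]
  refine (hM.image_linearEquiv Φ).isPiecewiseAlgebraic.semialgDim_le_add_of_fibers s ?_ fun y => ?_
  · rw [← hb, image_image]
    simp only [hψ]
    rw [← image_image ψ]
    exact semialgDim_image_le ψ _
  rcases ({a ∈ Φ '' M | s.domRestrict a = y}).eq_empty_or_nonempty with h | ⟨_, ⟨p, -, rfl⟩, hpy⟩
  · rw [h, semialgDim_empty]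
    exact bot_le
  have hsub : {a ∈ Φ '' M | s.domRestrict a = y} ⊆ Φ '' ({p.1} ×ˢ {y | (p.1, y) ∈ M}) := by
    rintro _ ⟨⟨q, hq, rfl⟩, hqy⟩
    have hqp : q.1 = p.1 := hψinj (by rw [← hψ, ← hψ, hqy, hpy])
    exact ⟨q, ⟨hqp, hqp ▸ hq⟩, rfl⟩
  calc semialgDim {a ∈ Φ '' M | s.domRestrict a = y}
      ≤ semialgDim (Φ '' ({p.1} ×ˢ {y | (p.1, y) ∈ M})) := semialgDim_mono hsub
    _ ≤ semialgDim {p.1} + semialgDim {y | (p.1, y) ∈ M} := by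
      rw [semialgDim_image_equiv]
      exact semialgDim_prod_le _ _
    _ ≤ 0 + e := add_le_add (semialgDim_singleton_le _) (he _)
    _ = e := zero_add _

theorem natCast_le_dimH {E : Type*} [NormedAddCommGroup E] [NormedSpace ℝ E]
    [FiniteDimensional ℝ E] {A : Set E} (hA : IsSemialgebraic A) {k : ℕ}
    (hk : k ≤ semialgDim A) : (k : ENNReal) ≤ dimH A := by
  let Φ := (finBasis ℝ E).equivFunL
  obtain ⟨f, hf⟩ := natCast_le_semialgDim_pi_iff.1
    (hk.trans_eq (semialgDim_image_equiv Φ.toLinearEquiv A).symm)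
  obtain ⟨B, hBA, hB, hBprime, hBf⟩ :=
    (hA.image_linearEquiv Φ.toLinearEquiv).isPiecewiseAlgebraic.exists_isPrime_vanishingIdeal hf
  have hlip : LipschitzWith 1 fun a : Fin (finrank ℝ E) → ℝ => a ∘ f :=
    LipschitzWith.of_dist_le_mul fun a b => by
      rw [NNReal.coe_one, one_mul]
      exact (dist_pi_le_iff dist_nonneg).2 fun i => dist_le_pi_dist a b (f i)
  calc (k : ENNReal) = dimH ((fun a => a ∘ f) '' B) := by
        rw [Real.dimH_of_nonempty_interior (hB.interior_image_comp_nonempty hBprime hBf),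
          finrank_fin_fun]
    _ ≤ dimH B := hlip.dimH_image_le B
    _ ≤ dimH (Φ '' A) := dimH_mono hBA
    _ = dimH A := Φ.dimH_image A

end IsSemialgebraic

end Semialgebraic

section LevelSets

variable {E F : Type*} [NormedAddCommGroup E] [NormedSpace ℝ E] [FiniteDimensional ℝ E]
  [NormedAddCommGroup F] [NormedSpace ℝ F]

theorem finrank_ker_add_of_surjective {r : ℕ} {f : E →L[ℝ] Fin r → ℝ}
    (hf : Function.Surjective f) : finrank ℝ f.ker + r = finrank ℝ E := by
  have h := LinearMap.finrank_range_add_finrank_ker (f : E →ₗ[ℝ] Fin r → ℝ)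
  rw [LinearMap.range_eq_top.2 hf, finrank_top, finrank_fin_fun] at h
  rw [add_comm]
  exact h

theorem dimH_le_of_forall_exists_submersion {A : Set E} {r : ℕ}
    (h : ∀ x ∈ A, ∃ (g : E → Fin r → ℝ) (g' : E →L[ℝ] Fin r → ℝ), HasStrictFDerivAt g g' x ∧
      Function.Surjective g' ∧ ∀ᶠ y in 𝓝[A] x, g y = g x) :
    dimH A ≤ (finrank ℝ E - r : ℕ) := by
  by_contra! hlt
  have : ProperSpace E := FiniteDimensional.proper_real E
  obtain ⟨x, hxA, hx⟩ := exists_mem_nhdsWithin_lt_dimH_of_lt_dimH hlt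
  obtain ⟨g, g', hg, hsurj, hgA⟩ := h x hxA
  have hr : g'.range = ⊤ := LinearMap.range_eq_top.2 hsurj
  let Φ := hg.implicitToOpenPartialHomeomorph g g' hr
  let η := hg.implicitFunction g g' hr (g x)
  obtain ⟨K, s, hs, hK⟩ := (hg.to_implicitFunction hr).exists_lipschitzOnWith
  have hΦ : ContinuousAt (fun y => (Φ y).2) x :=
    (Φ.continuousAt (hg.mem_implicitToOpenPartialHomeomorph_source hr)).snd
  have hΦx : (Φ x).2 = 0 := by simp [Φ]
  have hA : ∀ᶠ y in 𝓝[A] x, y ∈ η '' s := by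
    filter_upwards [nhdsWithin_le_nhds (hΦ.preimage_mem_nhds (by rwa [hΦx])),
      nhdsWithin_le_nhds (hg.eq_implicitFunction hr), hgA] with y hys hηy hgy
    exact ⟨(Φ y).2, hys, by simpa only [hgy] using hηy⟩
  refine (hx _ hA).not_ge ?_
  calc dimH (η '' s) ≤ dimH s := hK.dimH_image_le
    _ ≤ dimH (univ : Set g'.ker) := dimH_mono (subset_univ s)
    _ = (finrank ℝ E - r : ℕ) := by
      rw [Real.dimH_univ_eq_finrank, ← finrank_ker_add_of_surjective hsurj, Nat.add_sub_cancel]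

theorem ker_le_tangentSpaceOf_of_level_subset {r : ℕ} {g : E → Fin r → ℝ}
    {g' : E →L[ℝ] Fin r → ℝ} {x : E} (hg : HasStrictFDerivAt g g' x)
    (hsurj : Function.Surjective g') {A : Set E} (hA : ∀ᶠ y in 𝓝 x, g y = g x → y ∈ A) :
    g'.ker ≤ tangentSpaceOf A x := by
  have hr : g'.range = ⊤ := LinearMap.range_eq_top.2 hsurj
  let η := hg.implicitFunction g g' hr (g x)
  have hη : HasStrictFDerivAt η g'.ker.subtypeL 0 := hg.to_implicitFunction hr
  have hη0 : η 0 = x := hg.implicitFunction_apply_image hr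
  have hgη : ∀ᶠ z in 𝓝 (0 : g'.ker), g (η z) = g x :=
    (Continuous.tendsto' (f := fun z : g'.ker => (g x, z)) (by fun_prop) 0 _ rfl).eventually
      (hg.map_implicitFunction_eq hr)
  have hηA : η ⁻¹' A ∈ 𝓝 (0 : g'.ker) := by
    filter_upwards [hgη, hη.continuousAt.eventually (by rwa [hη0])] with z hz hzA
    exact hzA hz
  intro v hv
  have hv0 : (⟨v, hv⟩ : g'.ker) ∈ tangentConeAt ℝ (η ⁻¹' A) 0 := by
    rw [tangentConeAt_of_mem_nhds hηA]
    exact mem_univ _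
  have hvx := hη.hasFDerivAt.hasFDerivWithinAt.mapsTo_tangent_cone hv0
  rw [hη0] at hvx
  exact Submodule.subset_span (tangentConeAt_mono (image_preimage_subset η A) hvx)

namespace IsC1Submanifold

variable {d : ℕ} {A : Set E}

theorem dimH_le (hA : IsC1Submanifold d A) : dimH A ≤ d := by
  rcases A.eq_empty_or_nonempty with rfl | ⟨x₀, hx₀⟩
  · simp
  obtain ⟨m₀, -, -, hm₀, -⟩ := hA x₀ hx₀
  rw [(by omega : d = finrank ℝ E - m₀)]
  refine dimH_le_of_forall_exists_submersion fun x hx => ?_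
  obtain ⟨m, O, g, hm, hO, hxO, hg, hsurj, hAO⟩ := hA x hx
  obtain rfl : m = m₀ := by omega
  have hzero {y : E} (hyA : y ∈ A) (hyO : y ∈ O) : g y = 0 := (hAO.subset ⟨hyA, hyO⟩).2
  refine ⟨g, fderiv ℝ g x, (hg.contDiffAt (hO.mem_nhds hxO)).hasStrictFDerivAt one_ne_zero,
    hsurj, ?_⟩
  filter_upwards [self_mem_nhdsWithin, nhdsWithin_le_nhds (hO.mem_nhds hxO)] with y hyA hyO
  rw [hzero hyA hyO, hzero hx hxO]

theorem le_finrank_tangentSpaceOf (hA : IsC1Submanifold d A) {x : E} (hx : x ∈ A) :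
    d ≤ finrank ℝ (tangentSpaceOf A x) := by
  obtain ⟨m, O, g, hm, hO, hxO, hg, hsurj, hAO⟩ := hA x hx
  have hker : (fderiv ℝ g x).ker ≤ tangentSpaceOf A x := by
    refine ker_le_tangentSpaceOf_of_level_subset
      ((hg.contDiffAt (hO.mem_nhds hxO)).hasStrictFDerivAt one_ne_zero) hsurj ?_
    filter_upwards [hO.mem_nhds hxO] with y hyO hy
    exact (hAO.superset ⟨hyO, hy.trans (hAO.subset ⟨hx, hxO⟩).2⟩).1
  have := finrank_ker_add_of_surjective hsurj
  have := Submodule.finrank_mono hker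
  omega

end IsC1Submanifold

theorem exists_surjective_comp_of_le_finrank_range {D : E →ₗ[ℝ] F} {d : ℕ}
    (hd : d ≤ finrank ℝ (LinearMap.range D)) :
    ∃ L : F →ₗ[ℝ] Fin d → ℝ, Function.Surjective (L ∘ₗ D) := by
  obtain ⟨i, hi⟩ := finrank_le_iff_exists_linearMap.1 ((finrank_fin_fun ℝ).trans_le hd)
  obtain ⟨q, hq⟩ := i.exists_leftInverse_of_injective (LinearMap.ker_eq_bot.2 hi)
  obtain ⟨L, hL⟩ := q.exists_extend
  refine ⟨L, fun z => ?_⟩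
  obtain ⟨y, hy⟩ := (i z).2
  refine ⟨y, ?_⟩
  calc L (D y) = L (i z) := by rw [hy]
    _ = q (i z) := LinearMap.congr_fun hL (i z)
    _ = z := LinearMap.congr_fun hq z

theorem dimH_level_le_of_le_finrank_range [FiniteDimensional ℝ F] {U : Set E} (hU : IsOpen U)
    {G : E → F} (hG : ContDiffOn ℝ 1 G U) {d : ℕ}
    (hd : ∀ t ∈ U, d ≤ finrank ℝ (LinearMap.range (fderiv ℝ G t : E →ₗ[ℝ] F))) (w : F) :
    dimH {t ∈ U | G t = w} ≤ (finrank ℝ E - d : ℕ) := by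
  refine dimH_le_of_forall_exists_submersion fun t ht => ?_
  obtain ⟨L, hL⟩ := exists_surjective_comp_of_le_finrank_range (hd t ht.1)
  have hGt := (hG.contDiffAt (hU.mem_nhds ht.1)).hasStrictFDerivAt one_ne_zero
  refine ⟨_, _, (LinearMap.toContinuousLinearMap L).hasStrictFDerivAt.comp t hGt, hL, ?_⟩
  filter_upwards [self_mem_nhdsWithin] with y hy
  simp only [hy.2, ht.2]

end LevelSets

section GenericParameters

variable {P : Type*} [NormedAddCommGroup P] [NormedSpace ℝ P] [FiniteDimensional ℝ P]

theorem eval_mem_adjoin {ι : Type*} (q : MvPolynomial ι ℝ) :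
    (fun x : ι → ℝ => MvPolynomial.eval x q) ∈
      Algebra.adjoin ℝ (range fun (l : (ι → ℝ) →ₗ[ℝ] ℝ) (x : ι → ℝ) => l x) := by
  induction q using MvPolynomial.induction_on with
  | C r =>
    simp only [MvPolynomial.eval_C]
    exact Subalgebra.algebraMap_mem (Algebra.adjoin ℝ _) r
  | add p q hp hq =>
    simp only [map_add]
    exact Subalgebra.add_mem _ hp hq
  | mul_X p i hp =>
    simp only [map_mul, MvPolynomial.eval_X]
    exact Subalgebra.mul_mem _ hp (Algebra.subset_adjoin ⟨LinearMap.proj i, rfl⟩)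

theorem isSemialgebraic_setOf_eval_ne_zero {ι : Type*} (q : MvPolynomial ι ℝ) :
    IsSemialgebraic {x : ι → ℝ | MvPolynomial.eval x q ≠ 0} := by
  have hsq : {x : ι → ℝ | MvPolynomial.eval x q ≠ 0} = {x | 0 < MvPolynomial.eval x (q ^ 2)} := by
    ext x
    simp [sq_pos_iff]
  rw [hsq]
  exact .pos _ (eval_mem_adjoin _)

theorem semialgDim_biUnion_lt {α : Type*} {s : Set α} (hs : s.Finite) {T : α → Set P} {d : ℕ}
    (hT : ∀ a ∈ s, semialgDim (T a) < d) : semialgDim (⋃ a ∈ s, T a) < d := by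
  by_contra! hd
  obtain ⟨L, hL⟩ := natCast_le_semialgDim_iff.1 hd
  have := hs.to_subtype
  obtain ⟨a, ha⟩ := hL.exists_of_subset_iUnion (T := fun a : s => L '' T a)
    (by rw [biUnion_eq_iUnion, image_iUnion])
  exact (hT a a.2).not_ge (natCast_le_semialgDim_iff.2 ⟨L, ha⟩)

theorem exists_isOpen_dense_disjoint_of_semialgDim_lt {T : Set P}
    (hT : semialgDim T < finrank ℝ P) :
    ∃ V : Set P, IsOpen V ∧ Dense V ∧ IsSemialgebraic V ∧ Disjoint V T := by
  let φ := (finBasis ℝ P).equivFunL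
  have hφT : ¬ ZariskiDense (φ '' T) := fun h =>
    hT.not_ge (by simpa using natCard_le_semialgDim φ.toLinearMap h)
  simp only [ZariskiDense, not_forall] at hφT
  obtain ⟨q, hqT, hq0⟩ := hφT
  have hopen : IsOpen {x | MvPolynomial.eval x q ≠ 0} :=
    isOpen_ne_fun (MvPolynomial.continuous_eval q) continuous_const
  have hdense : Dense {x | MvPolynomial.eval x q ≠ 0} := by
    refine (interior_eq_empty_iff_dense_compl (s := {x | MvPolynomial.eval x q = 0})).1
      (not_nonempty_iff_eq_empty.1 fun h => ?_)
    exact hq0 (ZariskiDense.of_interior_nonempty h q fun x hx => hx)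
  refine ⟨φ ⁻¹' {x | MvPolynomial.eval x q ≠ 0}, hopen.preimage φ.continuous,
    hdense.preimage φ.toHomeomorph.isOpenMap,
    (isSemialgebraic_setOf_eval_ne_zero q).preimage_linearMap φ.toLinearMap, ?_⟩
  exact disjoint_left.2 fun t ht htT => ht (hqT _ ⟨t, htT, rfl⟩)

end GenericParameters

section Incidence

variable {P E X : Type*} {j : X → E} {U : Set P} {Ψ : P → X → X}

/-- The graph of a family `Ψ` of self-maps of `X`, with parameters in `U`, read through the
map `j` that places `X` in a vector space. -/
def familyGraph (j : X → E) (U : Set P) (Ψ : P → X → X) : Set (P × E × E) :=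
  {p | p.1 ∈ U ∧ ∃ x, p.2.1 = j x ∧ p.2.2 = j (Ψ p.1 x)}

/-- The triples `(x, Ψ t x, t)` with `x ∈ A` and `Ψ t x ∈ B`, points of `X` being read through `j`:
the fibre over the parameter `t` is a copy of `A ∩ Ψ t ⁻¹' B`. -/
def incidenceSet (j : X → E) (U : Set P) (Ψ : P → X → X) (A B : Set X) : Set ((E × E) × P) :=
  {p | p.2 ∈ U ∧ ∃ x ∈ A, Ψ p.2 x ∈ B ∧ p.1 = (j x, j (Ψ p.2 x))}

theorem fst_image_incidenceSet_subset (A B : Set X) :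
    Prod.fst '' incidenceSet j U Ψ A B ⊆ (j '' A) ×ˢ (j '' B) := by
  rintro _ ⟨⟨q, t⟩, ⟨-, x, hxA, hxB, hq : q = (j x, j (Ψ t x))⟩, rfl⟩
  subst hq
  exact ⟨⟨x, hxA, rfl⟩, ⟨_, hxB, rfl⟩⟩

theorem image_inter_preimage_subset_incidenceSet {t : P} (ht : t ∈ U) (A B : Set X) :
    j '' (A ∩ Ψ t ⁻¹' B) ⊆ Prod.fst '' {q | (q, t) ∈ incidenceSet j U Ψ A B} := by
  rintro _ ⟨x, ⟨hxA, hxB⟩, rfl⟩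
  exact ⟨(j x, j (Ψ t x)), ⟨ht, x, hxA, hxB, rfl⟩, rfl⟩

variable [AddCommGroup P] [Module ℝ P] [AddCommGroup E] [Module ℝ E]

theorem isSemialgebraic_incidenceSet (hj : Function.Injective j)
    (hΨ : IsSemialgebraic (familyGraph j U Ψ)) {A B : Set X} (hA : IsSemialgebraic (j '' A))
    (hB : IsSemialgebraic (j '' B)) : IsSemialgebraic (incidenceSet j U Ψ A B) := by
  let x : (E × E) × P →ₗ[ℝ] E := LinearMap.fst ℝ E E ∘ₗ LinearMap.fst ℝ (E × E) P
  let y : (E × E) × P →ₗ[ℝ] E := LinearMap.snd ℝ E E ∘ₗ LinearMap.fst ℝ (E × E) P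
  let t : (E × E) × P →ₗ[ℝ] P := LinearMap.snd ℝ (E × E) P
  have heq : incidenceSet j U Ψ A B =
      (t.prod (x.prod y)) ⁻¹' familyGraph j U Ψ ∩ (x ⁻¹' (j '' A) ∩ y ⁻¹' (j '' B)) := by
    ext ⟨⟨a, b⟩, τ⟩
    constructor
    · rintro ⟨hτ, p, hpA, hpB, hab⟩
      obtain ⟨ha, hb⟩ := Prod.mk.inj hab
      exact ⟨⟨hτ, p, ha, hb⟩, ⟨p, hpA, ha.symm⟩, ⟨_, hpB, hb.symm⟩⟩
    · rintro ⟨⟨hτ, p, hap : a = j p, hbp : b = j (Ψ τ p)⟩, ⟨p', hpA, hp'⟩, ⟨q, hqB, hq⟩⟩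
      obtain rfl : p' = p := hj (hp'.trans hap)
      obtain rfl : q = Ψ τ p' := hj (hq.trans hbp)
      exact ⟨hτ, p', hpA, hqB, Prod.ext hap hbp⟩
  rw [heq]
  exact (hΨ.preimage_linearMap _).inter ((hA.preimage_linearMap x).inter (hB.preimage_linearMap y))

variable [FiniteDimensional ℝ P] [FiniteDimensional ℝ E]

theorem natCast_add_le_semialgDim_incidenceSet {A B : Set X} {k m : ℕ}
    (h : m ≤ semialgDim {t ∈ U | k ≤ semialgDim (j '' (A ∩ Ψ t ⁻¹' B))}) :
    ((k + m : ℕ) : WithBot ℕ∞) ≤ semialgDim (incidenceSet j U Ψ A B) := by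
  refine natCast_add_le_semialgDim (h.trans (semialgDim_mono ?_))
  rintro t ⟨ht, hk⟩
  exact hk.trans ((semialgDim_mono (image_inter_preimage_subset_incidenceSet ht A B)).trans
    (semialgDim_image_le (LinearMap.fst ℝ E E) _))

end Incidence

section SubmersiveOrbits

variable {P E X : Type*} [NormedAddCommGroup P] [NormedSpace ℝ P]
  [NormedAddCommGroup E] [NormedSpace ℝ E] {j : X → E} {U : Set P} {Ψ : P → X → X}

/-- The part of a submersive family of self-maps of the stratum `S` that transversality depends on:
the stratum is preserved, and the orbit maps `t ↦ Ψ t x` of its points are `C¹` and submersive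
onto it, where `X` is viewed in `E` through `j`. -/
structure HasSubmersiveOrbits (j : X → E) (U : Set P) (Ψ : P → X → X) (S : Set X) : Prop where
  mapsTo : ∀ t ∈ U, MapsTo (Ψ t) S S
  contDiffOn : ∀ x ∈ S, ContDiffOn ℝ 1 (fun t => j (Ψ t x)) U
  tangentSpaceOf_le_range : ∀ t ∈ U, ∀ x ∈ S,
    tangentSpaceOf (j '' S) (j (Ψ t x)) ≤ (fderiv ℝ (fun τ => j (Ψ τ x)) t).range

theorem IsSubmersiveFamily.hasSubmersiveOrbits {𝕜 : Type*} [RCLike 𝕜] {n : ℕ}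
    {U : Set (Fin (n + 1) → 𝕜)} {S : Set (ProjSpace 𝕜 n)}
    {Ψ : (Fin (n + 1) → 𝕜) → ProjSpace 𝕜 n → ProjSpace 𝕜 n} (h : IsSubmersiveFamily U S Ψ) :
    HasSubmersiveOrbits projEmb U Ψ S where
  mapsTo := h.mapsTo
  contDiffOn x hx := by
    obtain ⟨G, hG, hGΨ⟩ := h.smooth
    have hGx : ContDiffOn ℝ 1 (fun t => G (t, projEmb x)) U :=
      hG.comp (contDiff_id.prodMk contDiff_const).contDiffOn fun t ht => ⟨ht, mem_image_of_mem _ hx⟩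
    exact hGx.congr fun t ht => (hGΨ t ht x hx).symm
  tangentSpaceOf_le_range t ht x hx := (h.submersive t ht x hx).ge

variable [FiniteDimensional ℝ P] [FiniteDimensional ℝ E]

theorem natCast_sub_le_of_lt_add {x : WithBot ℕ∞} {m d : ℕ} (h : m < x + d) :
    ((m + 1 - d : ℕ) : WithBot ℕ∞) ≤ x := by
  induction x with
  | bot => simp at h
  | coe x =>
    induction x with
    | top => exact le_top
    | coe e =>
      have hm : m < e + d := (Nat.cast_lt (α := WithBot ℕ∞)).1 (mod_cast h)
      exact Nat.cast_le.2 (show m + 1 - d ≤ e by omega)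

theorem IsC1Submanifold.semialgDim_le {A : Set E} {d : ℕ} (hA : IsC1Submanifold d A)
    (hAs : IsSemialgebraic A) : semialgDim A ≤ d :=
  le_of_forall_natCast_le fun _ hk => Nat.cast_le.2 <| (Nat.cast_le (α := ENNReal)).1 <|
    (hAs.natCast_le_dimH hk).trans hA.dimH_le

namespace HasSubmersiveOrbits

variable {S A B : Set X} {d : ℕ}

theorem le_finrank_range (h : HasSubmersiveOrbits j U Ψ S) (hS : IsC1Submanifold d (j '' S))
    {t : P} (ht : t ∈ U) {x : X} (hx : x ∈ S) :
    d ≤ finrank ℝ (fderiv ℝ (fun τ => j (Ψ τ x)) t).range :=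
  (hS.le_finrank_tangentSpaceOf (mem_image_of_mem j (h.mapsTo t ht hx))).trans
    (Submodule.finrank_mono (h.tangentSpaceOf_le_range t ht x hx))

theorem semialgDim_incidenceSet_fiber_le (h : HasSubmersiveOrbits j U Ψ S) (hU : IsOpen U)
    (hS : IsC1Submanifold d (j '' S)) (hj : Function.Injective j) (hAS : A ⊆ S)
    (hM : IsSemialgebraic (incidenceSet j U Ψ A B)) (p : E × E) :
    semialgDim {t | (p, t) ∈ incidenceSet j U Ψ A B} ≤ (finrank ℝ P - d : ℕ) := by
  rcases ({t | (p, t) ∈ incidenceSet j U Ψ A B}).eq_empty_or_nonempty with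
    he | ⟨t₀, -, x, hxA, -, hp⟩
  · rw [he, semialgDim_empty]
    exact bot_le
  have hlevel : {t | (p, t) ∈ incidenceSet j U Ψ A B} ⊆ {t ∈ U | j (Ψ t x) = p.2} := by
    rintro t ⟨ht, x', -, -, hx' : p = (j x', j (Ψ t x'))⟩
    have hxx' : x = x' := hj (congrArg Prod.fst (hp.symm.trans hx'))
    exact ⟨ht, by rw [hx', hxx']⟩
  refine le_of_forall_natCast_le fun k hk => Nat.cast_le.2 ((Nat.cast_le (α := ENNReal)).1 ?_)
  calc (k : ENNReal) ≤ dimH {t | (p, t) ∈ incidenceSet j U Ψ A B} :=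
        (hM.preimage_prodMk p).natCast_le_dimH hk
    _ ≤ dimH {t ∈ U | j (Ψ t x) = p.2} := dimH_mono hlevel
    _ ≤ (finrank ℝ P - d : ℕ) := dimH_level_le_of_le_finrank_range hU (h.contDiffOn x (hAS hxA))
      (fun t ht => h.le_finrank_range hS ht (hAS hxA)) p.2

theorem semialgDim_incidenceSet_le (h : HasSubmersiveOrbits j U Ψ S) (hU : IsOpen U)
    (hS : IsC1Submanifold d (j '' S)) (hj : Function.Injective j) (hAS : A ⊆ S)
    (hM : IsSemialgebraic (incidenceSet j U Ψ A B)) :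
    semialgDim (incidenceSet j U Ψ A B) ≤
      semialgDim (j '' A) + semialgDim (j '' B) + (finrank ℝ P - d : ℕ) :=
  calc semialgDim (incidenceSet j U Ψ A B)
      ≤ semialgDim (Prod.fst '' incidenceSet j U Ψ A B) + (finrank ℝ P - d : ℕ) :=
        hM.semialgDim_le_add_of_fibers (h.semialgDim_incidenceSet_fiber_le hU hS hj hAS hM)
    _ ≤ semialgDim ((j '' A) ×ˢ (j '' B)) + (finrank ℝ P - d : ℕ) := by
        gcongr
        exact semialgDim_mono (fst_image_incidenceSet_subset A B)
    _ ≤ _ := by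
        gcongr
        exact semialgDim_prod_le _ _

theorem semialgDim_setOf_excess_lt (h : HasSubmersiveOrbits j U Ψ S) (hU : IsOpen U)
    (hS : IsC1Submanifold d (j '' S)) (hSs : IsSemialgebraic (j '' S)) (hj : Function.Injective j)
    (hΨ : IsSemialgebraic (familyGraph j U Ψ)) (hAS : A ⊆ S)
    (hA : IsSemialgebraic (j '' A)) (hB : IsSemialgebraic (j '' B)) :
    semialgDim {t ∈ U | semialgDim (j '' A) + semialgDim (j '' B) <
      semialgDim (j '' (A ∩ Ψ t ⁻¹' B)) + semialgDim (j '' S)} < finrank ℝ P := by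
  by_contra! hfull
  obtain ⟨t, ht, hexc⟩ : {t ∈ U | semialgDim (j '' A) + semialgDim (j '' B) <
      semialgDim (j '' (A ∩ Ψ t ⁻¹' B)) + semialgDim (j '' S)}.Nonempty := by
    by_contra he
    rw [not_nonempty_iff_eq_empty.1 he, semialgDim_empty, le_bot_iff] at hfull
    exact WithBot.natCast_ne_bot _ hfull
  obtain ⟨x, hxA, hxB⟩ : (A ∩ Ψ t ⁻¹' B).Nonempty := by
    by_contra he
    rw [not_nonempty_iff_eq_empty.1 he, image_empty, semialgDim_empty, WithBot.bot_add] at hexc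
    exact not_lt_bot hexc
  obtain ⟨a, ha⟩ := exists_semialgDim_eq_natCast (⟨_, mem_image_of_mem j hxA⟩ : (j '' A).Nonempty)
  obtain ⟨b, hb⟩ := exists_semialgDim_eq_natCast (⟨_, mem_image_of_mem j hxB⟩ : (j '' B).Nonempty)
  have hdP : d ≤ finrank ℝ P :=
    (h.le_finrank_range hS ht (hAS hxA)).trans (LinearMap.finrank_range_le _)
  have hsub : {t ∈ U | semialgDim (j '' A) + semialgDim (j '' B) <
      semialgDim (j '' (A ∩ Ψ t ⁻¹' B)) + semialgDim (j '' S)} ⊆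
      {t ∈ U | ((a + b + 1 - d : ℕ) : WithBot ℕ∞) ≤ semialgDim (j '' (A ∩ Ψ t ⁻¹' B))} := by
    rintro τ ⟨hτ, hτexc⟩
    rw [ha, hb, ← Nat.cast_add] at hτexc
    exact ⟨hτ, natCast_sub_le_of_lt_add <|
      hτexc.trans_le (add_le_add_right (hS.semialgDim_le hSs) _)⟩
  have hlower := natCast_add_le_semialgDim_incidenceSet (hfull.trans (semialgDim_mono hsub))
  have hupper :=
    h.semialgDim_incidenceSet_le hU hS hj hAS (isSemialgebraic_incidenceSet hj hΨ hA hB)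
  have := hlower.trans hupper
  rw [ha, hb] at this
  norm_cast at this
  omega

end HasSubmersiveOrbits

theorem mainTheorem3_general {𝒮 : Set (Set X)} (h𝒮 : 𝒮.Finite) (hj : Function.Injective j)
    (h𝒮s : ∀ S ∈ 𝒮, IsSemialgebraic (j '' S)) (h𝒮d : ∀ S ∈ 𝒮, ∃ d, IsC1Submanifold d (j '' S))
    (hUo : IsOpen U) (hUs : IsSemialgebraic U) (hΨs : IsSemialgebraic (familyGraph j U Ψ))
    (hΨ : ∀ S ∈ 𝒮, HasSubmersiveOrbits j U Ψ S) {Z W : Set X} (hZ : IsSemialgebraic (j '' Z))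
    (hW : IsSemialgebraic (j '' W)) :
    ∃ U' : Set P, U' ⊆ U ∧ IsOpen U' ∧ U ⊆ closure U' ∧ IsSemialgebraic U' ∧
      ∀ t ∈ U', ∀ S ∈ 𝒮, semialgDim (j '' (Z ∩ Ψ t ⁻¹' W ∩ S)) + semialgDim (j '' S) ≤
        semialgDim (j '' (Z ∩ S)) + semialgDim (j '' (W ∩ S)) := by
  let excess (S : Set X) : Set P := {t ∈ U | semialgDim (j '' (Z ∩ S)) + semialgDim (j '' (W ∩ S)) <
    semialgDim (j '' (Z ∩ S ∩ Ψ t ⁻¹' (W ∩ S))) + semialgDim (j '' S)}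
  have hexcess : ∀ S ∈ 𝒮, semialgDim (excess S) < finrank ℝ P := fun S hS => by
    obtain ⟨d, hd⟩ := h𝒮d S hS
    have hinter {A : Set X} (hA : IsSemialgebraic (j '' A)) : IsSemialgebraic (j '' (A ∩ S)) :=
      image_inter hj ▸ hA.inter (h𝒮s S hS)
    exact (hΨ S hS).semialgDim_setOf_excess_lt hUo hd (h𝒮s S hS) hj hΨs inter_subset_right
      (hinter hZ) (hinter hW)
  obtain ⟨V, hVo, hVd, hVs, hV⟩ :=
    exists_isOpen_dense_disjoint_of_semialgDim_lt (semialgDim_biUnion_lt h𝒮 hexcess)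
  refine ⟨U ∩ V, inter_subset_left, hUo.inter hVo, hVd.open_subset_closure_inter hUo,
    hUs.inter hVs, fun t ⟨htU, htV⟩ S hS => ?_⟩
  have htrace : Z ∩ Ψ t ⁻¹' W ∩ S = Z ∩ S ∩ Ψ t ⁻¹' (W ∩ S) := by
    ext x
    have := (hΨ S hS).mapsTo t htU (x := x)
    simp only [mem_inter_iff, mem_preimage]
    tauto
  rw [htrace]
  by_contra! hlt
  exact disjoint_left.1 hV htV (mem_biUnion hS ⟨htU, hlt⟩)

end SubmersiveOrbits

theorem mainTheorem3 {𝕜 : Type*} [RCLike 𝕜] (n : ℕ)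
    (𝒮 : Set (Set (ProjSpace 𝕜 n))) (h𝒮 : IsAlgebraicStratification 𝒮)
    (U : Set (Fin (n + 1) → 𝕜)) (hUo : IsOpen U) (hU0 : (0 : Fin (n + 1) → 𝕜) ∈ U)
    (hUs : IsSemialgebraic U)
    (Ψ : (Fin (n + 1) → 𝕜) → ProjSpace 𝕜 n → ProjSpace 𝕜 n)
    (hΨs : IsSemialgebraicFamily U Ψ)
    (hΨ : ∀ S ∈ 𝒮, IsSubmersiveFamily U S Ψ)
    (hΨ0 : ∀ x, Ψ 0 x = x)
    (Z W : Set (ProjSpace 𝕜 n)) (hZ : IsProjSemialgebraic Z) (hW : IsProjSemialgebraic W) :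
    ∃ U' : Set (Fin (n + 1) → 𝕜), U' ⊆ U ∧ IsOpen U' ∧ U ⊆ closure U' ∧ IsSemialgebraic U' ∧
      ∀ t ∈ U', ∀ S ∈ 𝒮,
        projDim (Z ∩ Ψ t ⁻¹' W ∩ S) + projDim S ≤ projDim (Z ∩ S) + projDim (W ∩ S) :=
  mainTheorem3_general h𝒮.finite projEmb_injective h𝒮.semialgebraic h𝒮.smooth hUo hUs hΨs
    (fun S hS => (hΨ S hS).hasSubmersiveOrbits) hZ hW
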